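/- A $d$-polytope is a $d$-dimensional convex hull of finitely many points in $\mathbb{R}^d$. For $1\le j\le d-1$ it is $j$-simplicial if all its $j$-faces are simplices; for $1\le i\le d-1$ it is $i$-simple if every $(d-i-1)$-face lies in exactly $i+1$ facets. A vertex of a $d$-polytope is simple if it lies in exactly $d$ facets. Let $P_1$ be a $d$-polytope with a facet $F=[u_1,\dots,u_d]$ that is a simplex with (ordered) vertices $u_1,\dots,u_d$, and let $H_k$ be the facet of $P_1$ other than $F$ that contains all $u_m$ with $m\ne k$. Let $P_2$ be a $d$-polytope with a simple vertex $v$ whose neighbors (the vertices joined to $v$ by an edge) are ordered as $u'_1,\dots,u'_d$. A merge $P_1\rhd P_2$ along $F$ and $v$ (with these orderings) is obtained as follows. Apply to $P_1$ a projective transformation $\varphi$, defined on all of $P_1$, such that the hyperplanes $\operatorname{aff}\varphi(F),\operatorname{aff}\varphi(H_1),\dots,\operatorname{aff}\varphi(H_d)$ are the facet hyperplanes of a $d$-simplex $\Sigma$ with $\varphi(P_1)\subseteq\Sigma$; let $u$ be the vertex of $\Sigma$ other than $\varphi(u_1),\dots,\varphi(u_d)$. Apply to $P_2$ the affine transformation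 $T$ with $T(v)=u$ and $T(u'_k)=\varphi(u_k)$ for all $k$. Then $$P_1\rhd P_2=\varphi(P_1)\cup\operatorname{conv}\bigl(V(T(P_2))\setminus\{u\}\bigr),$$ where $V(\cdot)$ denotes the set of vertices. **Theorem.** Let $d\ge 2$ and $1\le i,j\le d-1$, and let $P_1$ and $P_2$ be $d$-polytopes with a simplex facet $F$ and a simple vertex $v$, respectively, with orderings of the vertices of $F$ and of the neighbors of $v$ as above. Then a merge $P_1\rhd P_2$ along $F$ and $v$ exists, and every such merge is a $d$-polytope. If $P_1$ and $P_2$ are $j$-simplicial, then so is every such $P_1\rhd P_2$. If $P_1$ and $P_2$ are $i$-simple, then so is every such $P_1\rhd P_2$. -/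

import Mathlib

namespace PolytopeMerge

/-- Euclidean `d`-space. -/
abbrev E (d : ℕ) : Type := EuclideanSpace ℝ (Fin d)

variable {d : ℕ}

/-- The dimension of (the affine span of) a nonempty set. It is used for nonempty sets only. -/
noncomputable def dim (S : Set (E d)) : ℕ := Module.finrank ℝ (vectorSpan ℝ S)

/-- `P` is a `d`-polytope in `ℝ^d`: the convex hull of a finite set, of full dimension `d`. -/
def IsPolytope (P : Set (E d)) : Prop :=
  (∃ s : Set (E d), s.Finite ∧ P = convexHull ℝ s) ∧ P.Nonempty ∧ dim P = d

/-- `G` is a `k`-face of `P`. The faces of `P` (with `P` and `∅`) are its exposed subsets, i.e. the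
sets on which a linear functional attains its maximum over `P`. -/
def IsFace (P : Set (E d)) (k : ℕ) (G : Set (E d)) : Prop :=
  IsExposed ℝ P G ∧ G.Nonempty ∧ dim G = k

/-- `H` is a facet of the `d`-polytope `P`: a face of dimension `d - 1`. -/
def IsFacet (P H : Set (E d)) : Prop :=
  IsExposed ℝ P H ∧ H.Nonempty ∧ dim H + 1 = d

/-- The vertices of `P`: the points `x` such that `{x}` is a face. -/
def vertices (P : Set (E d)) : Set (E d) := P.exposedPoints ℝ

/-- `S` is a `k`-simplex: the convex hull of `k + 1` affinely independent points. -/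
def IsSimplex (k : ℕ) (S : Set (E d)) : Prop :=
  ∃ p : Fin (k + 1) → E d, AffineIndependent ℝ p ∧ S = convexHull ℝ (Set.range p)

/-- `P` is `j`-simplicial: all its `j`-faces are simplices. -/
def IsSimplicial (j : ℕ) (P : Set (E d)) : Prop :=
  ∀ G, IsFace P j G → IsSimplex j G

/-- `P` is `i`-simple (`i ≤ d - 1`): every `(d - i - 1)`-face is contained in exactly `i + 1`
facets. -/
def IsSimple (i : ℕ) (P : Set (E d)) : Prop :=
  ∀ G, IsFace P (d - i - 1) G → {H | IsFacet P H ∧ G ⊆ H}.ncard = i + 1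

/-- `v` is a simple vertex of the `d`-polytope `P`: it lies in exactly `d` facets. -/
def IsSimpleVertex (P : Set (E d)) (v : E d) : Prop :=
  v ∈ vertices P ∧ {H | IsFacet P H ∧ v ∈ H}.ncard = d

/-- The neighbors of `v`: the other vertices that are joined to `v` by an edge of `P`. -/
def neighbors (P : Set (E d)) (v : E d) : Set (E d) :=
  {w | w ∈ vertices P ∧ w ≠ v ∧ IsFace P 1 (segment ℝ v w)}

/-- `a 0, …, a (d - 1)` is an ordering of the vertices of a simplex facet of `P`, that facet being
their convex hull. -/
def IsSimplexFacet (P : Set (E d)) (a : Fin d → E d) : Prop :=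
  AffineIndependent ℝ a ∧ IsFacet P (convexHull ℝ (Set.range a))

/-- `H` is a facet of `P` adjacent to the simplex facet `F` with vertices `a` along the ridge
of `F` spanned by all vertices but `a k`. -/
def IsAdjacentFacet (P : Set (E d)) (a : Fin d → E d) (k : Fin d) (H : Set (E d)) : Prop :=
  IsFacet P H ∧ H ≠ convexHull ℝ (Set.range a) ∧ convexHull ℝ (a '' {k}ᶜ) ⊆ H

/-- The denominator of the projective transformation of `ℝ^d` with homogeneous form `L`. -/
def projDenom (L : (E d × ℝ) ≃ₗ[ℝ] (E d × ℝ)) (x : E d) : ℝ := (L (x, 1)).2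

/-- The projective transformation `x ↦ (A x + b) / (⟨c, x⟩ + e)` with homogeneous form the
invertible linear map `L (x, t) = (A x + t b, ⟨c, x⟩ + t e)`. It is meaningful where the
denominator does not vanish. -/
noncomputable def projMap (L : (E d × ℝ) ≃ₗ[ℝ] (E d × ℝ)) (x : E d) : E d :=
  (projDenom L x)⁻¹ • (L (x, 1)).1

/-- `Q` is a merge of `P₁` and `P₂` along the simplex facet `F` of `P₁` with ordered vertices `a`
and the simple vertex `v` of `P₂` with ordered neighbors `b`.

A projective transformation `φ`, defined on all of `P₁`, moves `P₁` to a polytope such that the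
hyperplanes spanned by `φ(F)` and by the images of the facets adjacent to `F` are the facet
hyperplanes of a `d`-simplex `Σ = [u, φ(a 0), …, φ(a (d - 1))]` that contains `φ(P₁)`; the affine
transformation `T` with `T v = u` and `T (b k) = φ (a k)` moves `P₂`. Then `Q` is the union of
`φ(P₁)` and the convex hull of the vertices of `T(P₂)` other than `u = T v`. -/
def IsMerge (P₁ : Set (E d)) (a : Fin d → E d) (P₂ : Set (E d)) (v : E d) (b : Fin d → E d)
    (Q : Set (E d)) : Prop :=
  ∃ (L : (E d × ℝ) ≃ₗ[ℝ] (E d × ℝ)) (u : E d) (T : E d ≃ᵃ[ℝ] E d),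
    (∀ x ∈ P₁, projDenom L x ≠ 0) ∧
    AffineIndependent ℝ (Fin.cons u (fun k => projMap L (a k)) : Fin (d + 1) → E d) ∧
    (∀ k H, IsAdjacentFacet P₁ a k H →
      affineSpan ℝ (projMap L '' H) =
        affineSpan ℝ (insert u ((fun m => projMap L (a m)) '' {k}ᶜ))) ∧
    projMap L '' P₁ ⊆ convexHull ℝ (insert u (Set.range fun k => projMap L (a k))) ∧
    T v = u ∧ (∀ k, T (b k) = projMap L (a k)) ∧
    Q = projMap L '' P₁ ∪ convexHull ℝ (vertices (T '' P₂) \ {u})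

end PolytopeMerge

/-!
Faces are handled in homogeneous coordinates: the nonempty faces of a polytope `P` are the zero sets
of the affine functions, i.e. linear forms on `ℝ^d × ℝ`, that are nonnegative on `P`, and the
dimension of a set is one less than the rank of its homogeneous coordinates. In this language the
face structure is visibly invariant under projective transformations with positive denominator.

An affine transformation moves a merge to standard position: `u` becomes the origin and the `φ(u_k)`
become the unit vectors. Then `P = φ(P₁)` lies in the standard simplex `{x ≥ 0, ∑ x_k ≤ 1}`, while
`R = T(P₂)` lies in the orthant, because a polytope is contained in the cone spanned by the edges at
a vertex (`sub_mem_of_neighbors`). The merge is `glue P R`, the union of `P` and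
`{x ∈ R | ∑ x_k ≥ 1}` (`IsMerge.exists_glue`). A segment from one part to the other crosses the
hyperplane `∑ x_k = 1` in the common simplex facet, so the union is convex and hence a polytope.

An affine function that is nonnegative on the union is nonnegative at the unit vectors, so its
behavior depends on its value at the origin. If that is positive, the face it defines is a face of
`R` that misses the origin; if it is negative, a face of `P`; if it is zero, the intersection of the
union with a coordinate subspace. For `j`-simplicial `P` and `R` each of these is a simplex if its
dimension is `j`: in the third case it either lies in the common simplex facet, or the corresponding
coordinate face of `R` is the `j`-simplex spanned by the origin and `j` unit vectors and adds
nothing to the coordinate face of `P` (`isSimplicial_glue`).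

The facets of the union are the facets of `R` that miss the origin, the facets of `P` whose
hyperplane separates it from the origin, and the `d` coordinate facets. A coordinate face whose span
contains the origin lies in no facets but coordinate facets, which are easily counted. Any other
face is a face of `R` that misses the origin or a face of `P` off the simplex facet, and lies in as
many facets of the union as of `R` or `P`, once it is known that no facet of the second kind
contains a face of dimension `d - i - 1` of the simplex facet when `P` is `i`-simple
(`isSimple_glue`). For this one needs that a face of `P` that is separated from the origin lies in a
facet with the same property (`exists_facet_form`).

A merge exists because beyond each ridge of a simplex facet there is exactly one other facet
(`exists_adjacent_form`): the functions of these `d` facets and of the simplex facet are independent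
and serve as homogeneous coordinates in which the required hyperplanes bound the standard simplex
(`exists_merge`).
-/

namespace PolytopeMerge

variable {d : ℕ}

/-! ### Homogeneous coordinates -/

/-- Linear forms on `ℝ^d × ℝ`. Restricted to the points `(x, 1)` they are the affine functions
on `ℝ^d`. -/
abbrev Form (d : ℕ) : Type := (E d × ℝ) →ₗ[ℝ] ℝ

/-- The homogeneous coordinates `(x, 1)` of a point. -/
def hom (x : E d) : E d × ℝ := (x, 1)

/-- The linear span of the homogeneous coordinates of the points of `S`. -/
def homSpan (S : Set (E d)) : Submodule ℝ (E d × ℝ) := Submodule.span ℝ (hom '' S)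

/-- The points of `P` at which the affine function `Λ` vanishes. If `Λ` is nonnegative on `P`, this
is a face of `P`. -/
def zeroSet (P : Set (E d)) (Λ : Form d) : Set (E d) := {x | x ∈ P ∧ Λ (hom x) = 0}

/-- The affine function `Λ` is nonnegative on `P`. -/
def Valid (P : Set (E d)) (Λ : Form d) : Prop := ∀ x ∈ P, 0 ≤ Λ (hom x)

lemma hom_injective : Function.Injective (hom : E d → E d × ℝ) := fun _ _ h => congrArg Prod.fst h

lemma hom_ne_zero (x : E d) : hom x ≠ 0 := fun h => one_ne_zero (congrArg Prod.snd h)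

lemma hom_mem_homSpan {S : Set (E d)} {x : E d} (hx : x ∈ S) : hom x ∈ homSpan S :=
  Submodule.subset_span ⟨x, hx, rfl⟩

lemma homSpan_mono {S T : Set (E d)} (h : S ⊆ T) : homSpan S ≤ homSpan T :=
  Submodule.span_mono (Set.image_mono h)

lemma homSpan_le {S : Set (E d)} {W : Submodule ℝ (E d × ℝ)} (h : ∀ x ∈ S, hom x ∈ W) :
    homSpan S ≤ W := by
  refine Submodule.span_le.2 ?_
  rintro _ ⟨x, hx, rfl⟩
  exact h x hx

lemma eq_zero_of_mem_homSpan {S : Set (E d)} {Λ : Form d} (h : ∀ x ∈ S, Λ (hom x) = 0)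
    {y : E d × ℝ} (hy : y ∈ homSpan S) : Λ y = 0 :=
  homSpan_le (W := LinearMap.ker Λ) h hy

lemma zeroSet_subset (P : Set (E d)) (Λ : Form d) : zeroSet P Λ ⊆ P := fun _ h => h.1

lemma form_combo (Λ : Form d) (x y : E d) {s t : ℝ} (h : s + t = 1) :
    Λ (hom (s • x + t • y)) = s * Λ (hom x) + t * Λ (hom y) := by
  have : hom (s • x + t • y) = s • hom x + t • hom y := by
    simp [hom, h]
  rw [this]; simp

lemma convex_form_nonneg (Λ : Form d) : Convex ℝ {x | 0 ≤ Λ (hom x)} := by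
  intro x hx y hy s t hs ht hst
  simp only [Set.mem_ofPred_eq] at *
  rw [form_combo Λ x y hst]
  positivity

lemma convex_form_pos (Λ : Form d) : Convex ℝ {x | 0 < Λ (hom x)} := by
  intro x hx y hy s t hs ht hst
  simp only [Set.mem_ofPred_eq] at *
  rw [form_combo Λ x y hst]
  rcases hs.eq_or_lt with rfl | hs
  · have : t = 1 := by linarith
    subst this; simpa using hy
  · have := mul_pos hs hx
    have := mul_nonneg ht hy.le
    linarith

lemma convex_hom_mem (W : Submodule ℝ (E d × ℝ)) : Convex ℝ {x | hom x ∈ W} := by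
  intro x hx y hy s t hs ht hst
  have : hom (s • x + t • y) = s • hom x + t • hom y := by
    simp [hom, hst]
  simp only [Set.mem_ofPred_eq] at *
  rw [this]
  exact W.add_mem (W.smul_mem _ hx) (W.smul_mem _ hy)

lemma valid_convexHull {s : Set (E d)} {Λ : Form d} (h : Valid s Λ) : Valid (convexHull ℝ s) Λ :=
  convexHull_min h (convex_form_nonneg Λ)

lemma homSpan_convexHull (s : Set (E d)) : homSpan (convexHull ℝ s) = homSpan s :=
  le_antisymm
    (homSpan_le (convexHull_min (fun _ hx => hom_mem_homSpan hx) (convex_hom_mem (homSpan s))))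
    (homSpan_mono (subset_convexHull ℝ s))

lemma zeroSet_convexHull {s : Set (E d)} {Λ : Form d} (h : Valid s Λ) :
    zeroSet (convexHull ℝ s) Λ = convexHull ℝ (zeroSet s Λ) := by
  apply Set.Subset.antisymm
  · have key : convexHull ℝ s ⊆ {x | x ∈ convexHull ℝ (zeroSet s Λ) ∨ 0 < Λ (hom x)} := by
      refine convexHull_min ?_ ?_
      · intro x hx
        rcases (h x hx).eq_or_lt with h0 | h0
        · exact Or.inl (subset_convexHull ℝ _ ⟨hx, h0.symm⟩)
        · exact Or.inr h0
      · have hnn : ∀ z, z ∈ convexHull ℝ (zeroSet s Λ) → 0 ≤ Λ (hom z) :=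
          valid_convexHull fun z hz => hz.2.ge
        intro x hx y hy p q hp hq hpq
        rcases hp.eq_or_lt with rfl | hp
        · have : q = 1 := by linarith
          subst this; simpa using hy
        rcases hq.eq_or_lt with rfl | hq
        · have : p = 1 := by linarith
          subst this; simpa using hx
        rcases hx with hx | hx
        · rcases hy with hy | hy
          · exact Or.inl (convex_convexHull ℝ _ hx hy hp.le hq.le hpq)
          · refine Or.inr ?_
            rw [form_combo Λ x y hpq]
            have := mul_pos hq hy
            have := mul_nonneg hp.le (hnn x hx)
            linarith
        · refine Or.inr ?_
          rw [form_combo Λ x y hpq]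
          have hy' : 0 ≤ Λ (hom y) := by
            rcases hy with hy | hy
            · exact hnn y hy
            · exact hy.le
          have := mul_pos hp hx
          have := mul_nonneg hq.le hy'
          linarith
    rintro x ⟨hx, hx0⟩
    rcases key hx with h | h
    · exact h
    · simp only [hx0, lt_irrefl] at h
  · intro x hx
    refine ⟨convexHull_mono (zeroSet_subset s Λ) hx, ?_⟩
    have := eq_zero_of_mem_homSpan (S := zeroSet s Λ) (Λ := Λ) (fun x hx => hx.2)
      (y := hom x) (by rw [← homSpan_convexHull]; exact hom_mem_homSpan hx)
    exact this

/-- Nonempty exposed sets are the nonempty zero sets of affine functions that are nonnegative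
on `P`. -/
lemma isExposed_iff {P G : Set (E d)} (hG : G.Nonempty) :
    IsExposed ℝ P G ↔ ∃ Λ : Form d, Valid P Λ ∧ G = zeroSet P Λ := by
  constructor
  · intro h
    obtain ⟨l, hl⟩ := h hG
    obtain ⟨g, hg⟩ := hG
    have hg' := hg
    rw [hl] at hg'
    let Λ : Form d := (l g) • LinearMap.snd ℝ (E d) ℝ - l.toLinearMap ∘ₗ LinearMap.fst ℝ (E d) ℝ
    have hΛ : ∀ x, Λ (hom x) = l g - l x := by intro x; simp [Λ, hom]
    refine ⟨Λ, fun x hx => ?_, ?_⟩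
    · rw [hΛ]; linarith [hg'.2 x hx]
    · rw [hl]
      ext x
      simp only [zeroSet, Set.mem_ofPred_eq, hΛ]
      constructor
      · rintro ⟨h1, h2⟩
        exact ⟨h1, by linarith [h2 g hg'.1, hg'.2 x h1]⟩
      · rintro ⟨h1, h2⟩
        exact ⟨h1, fun y hy => by linarith [hg'.2 y hy]⟩
  · rintro ⟨Λ, hv, rfl⟩ -
    let l : StrongDual ℝ (E d) := -(LinearMap.toContinuousLinearMap (Λ ∘ₗ LinearMap.inl ℝ (E d) ℝ))
    have hl : ∀ x, l x = Λ (0, 1) - Λ (hom x) := by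
      intro x
      have : hom x = (x, 0) + (0, 1) := by simp [hom]
      rw [this, map_add]
      simp [l]
    obtain ⟨g, hg⟩ := hG
    refine ⟨l, ?_⟩
    ext x
    simp only [zeroSet, Set.mem_ofPred_eq, hl]
    constructor
    · rintro ⟨h1, h2⟩
      exact ⟨h1, fun y hy => by linarith [hv y hy]⟩
    · rintro ⟨h1, h2⟩
      exact ⟨h1, by linarith [h2 g hg.1, hg.2, hv x h1]⟩

lemma dim_add_one {S : Set (E d)} (hS : S.Nonempty) :
    dim S + 1 = Module.finrank ℝ (homSpan S) := by
  obtain ⟨x₀, h₀⟩ := hS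
  have hmap : ∀ v ∈ vectorSpan ℝ S, ((v, 0) : E d × ℝ) ∈ homSpan S := by
    have : vectorSpan ℝ S ≤ (homSpan S).comap (LinearMap.inl ℝ (E d) ℝ) := by
      rw [vectorSpan_def, Submodule.span_le]
      rintro _ ⟨x, hx, y, hy, rfl⟩
      have := (homSpan S).sub_mem (hom_mem_homSpan hx) (hom_mem_homSpan hy)
      simpa [hom] using this
    exact this
  have hspan : homSpan S =
      Submodule.map (LinearMap.inl ℝ (E d) ℝ) (vectorSpan ℝ S) ⊔ Submodule.span ℝ {hom x₀} := by
    apply le_antisymm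
    · refine homSpan_le fun x hx => ?_
      have : hom x = LinearMap.inl ℝ (E d) ℝ (x - x₀) + hom x₀ := by simp [hom]
      rw [this]
      exact Submodule.add_mem_sup
        (Submodule.mem_map_of_mem (vsub_mem_vectorSpan ℝ hx h₀))
        (Submodule.mem_span_singleton_self _)
    · refine sup_le ?_ ?_
      · rintro _ ⟨v, hv, rfl⟩
        exact hmap v hv
      · rw [Submodule.span_singleton_le_iff_mem]
        exact hom_mem_homSpan h₀
  have hdisj : Submodule.map (LinearMap.inl ℝ (E d) ℝ) (vectorSpan ℝ S) ⊓
      Submodule.span ℝ {hom x₀} = ⊥ := by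
    rw [eq_bot_iff]
    rintro y ⟨⟨v, -, rfl⟩, h2⟩
    obtain ⟨c, hc⟩ := Submodule.mem_span_singleton.1 h2
    have h3 := congrArg Prod.snd hc
    have hc0 : c = 0 := by simpa [hom] using h3
    rw [Submodule.mem_bot, ← hc, hc0, zero_smul]
  have h := Submodule.finrank_sup_add_finrank_inf_eq
    (Submodule.map (LinearMap.inl ℝ (E d) ℝ) (vectorSpan ℝ S)) (Submodule.span ℝ {hom x₀})
  rw [hdisj, finrank_bot, finrank_span_singleton (hom_ne_zero x₀), ← hspan,
    ← (Submodule.equivMapOfInjective _ LinearMap.inl_injective _).finrank_eq] at h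
  unfold dim
  omega

lemma finrank_hom : Module.finrank ℝ (E d × ℝ) = d + 1 := by simp [E]

lemma affineIndependent_iff_hom {ι : Type*} {p : ι → E d} :
    AffineIndependent ℝ p ↔ LinearIndependent ℝ (fun i => hom (p i)) := by
  rw [affineIndependent_iff, linearIndependent_iff']
  have h : ∀ (s : Finset ι) (w : ι → ℝ), ∑ i ∈ s, w i • hom (p i) = 0 ↔
      (s.sum w = 0 ∧ ∑ e ∈ s, w e • p e = 0) := by
    intro s w
    rw [Prod.ext_iff, Prod.fst_sum, Prod.snd_sum]
    simp [hom, and_comm]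
  constructor
  · intro H s w hw
    exact H s w ((h s w).1 hw).1 ((h s w).1 hw).2
  · intro H s w h1 h2
    exact H s w ((h s w).2 ⟨h1, h2⟩)

lemma isFace_iff {P G : Set (E d)} {k : ℕ} :
    IsFace P k G ↔ G.Nonempty ∧ (∃ Λ : Form d, Valid P Λ ∧ G = zeroSet P Λ) ∧
      Module.finrank ℝ (homSpan G) = k + 1 := by
  unfold IsFace
  constructor
  · rintro ⟨h1, h2, h3⟩
    exact ⟨h2, (isExposed_iff h2).1 h1, by rw [← dim_add_one h2, h3]⟩
  · rintro ⟨h2, h1, h3⟩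
    exact ⟨(isExposed_iff h2).2 h1, h2, by rw [← dim_add_one h2] at h3; omega⟩

lemma isFacet_iff {P H : Set (E d)} :
    IsFacet P H ↔ H.Nonempty ∧ (∃ Λ : Form d, Valid P Λ ∧ H = zeroSet P Λ) ∧
      Module.finrank ℝ (homSpan H) = d := by
  unfold IsFacet
  constructor
  · rintro ⟨h1, h2, h3⟩
    exact ⟨h2, (isExposed_iff h2).1 h1, by rw [← dim_add_one h2, h3]⟩
  · rintro ⟨h2, h1, h3⟩
    exact ⟨(isExposed_iff h2).2 h1, h2, by rw [← dim_add_one h2] at h3; omega⟩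

lemma homSpan_eq_top_iff {P : Set (E d)} (hP : P.Nonempty) : homSpan P = ⊤ ↔ dim P = d := by
  have h := dim_add_one hP
  constructor
  · intro ht
    rw [ht, finrank_top, finrank_hom] at h
    omega
  · intro hd
    apply Submodule.eq_top_of_finrank_eq
    rw [finrank_hom, ← h, hd]

lemma IsPolytope.homSpan_eq_top {P : Set (E d)} (hP : IsPolytope P) : homSpan P = ⊤ :=
  (homSpan_eq_top_iff hP.2.1).2 hP.2.2

lemma IsPolytope.convex {P : Set (E d)} (hP : IsPolytope P) : Convex ℝ P := by
  obtain ⟨⟨s, -, rfl⟩, -⟩ := hP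
  exact convex_convexHull ℝ s

lemma form_eq_zero {P : Set (E d)} (hP : homSpan P = ⊤) {Λ : Form d}
    (h : ∀ x ∈ P, Λ (hom x) = 0) : Λ = 0 := by
  ext1
  · ext x; exact eq_zero_of_mem_homSpan h (by rw [hP]; trivial)
  · ext; exact eq_zero_of_mem_homSpan h (by rw [hP]; trivial)

/-- A point `x` of `conv s`, `s` finite, that is extreme is also exposed: `x` is not in the closed
convex hull of the other points of `s` and can be separated from it. -/
lemma mem_vertices_of_extreme {s : Set (E d)} (hs : s.Finite) {x : E d}
    (hx : x ∈ (convexHull ℝ s).extremePoints ℝ) : x ∈ vertices (convexHull ℝ s) := by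
  have hxs : x ∈ s := extremePoints_convexHull_subset hx
  have hx' : x ∉ convexHull ℝ (s \ {x}) := by
    intro h
    have := inter_extremePoints_subset_extremePoints_of_subset (𝕜 := ℝ)
      (convexHull_mono (𝕜 := ℝ) (Set.sdiff_subset : s \ {x} ⊆ s)) ⟨h, hx⟩
    exact (extremePoints_convexHull_subset this).2 rfl
  obtain ⟨f, c, hf1, hf2⟩ := geometric_hahn_banach_point_closed (convex_convexHull ℝ (s \ {x}))
    ((hs.subset Set.sdiff_subset).isClosed_convexHull ℝ) hx'
  let Λ : Form d := f.toLinearMap ∘ₗ LinearMap.fst ℝ (E d) ℝ - (f x) • LinearMap.snd ℝ (E d) ℝ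
  have hΛ : ∀ y, Λ (hom y) = f y - f x := by intro y; simp [Λ, hom]
  have hval : ∀ y ∈ s, y ≠ x → 0 < Λ (hom y) := by
    intro y hy hyx
    rw [hΛ]
    linarith [hf2 y (subset_convexHull ℝ _ ⟨hy, hyx⟩)]
  have hv : Valid s Λ := by
    intro y hy
    by_cases hyx : y = x
    · rw [hΛ, hyx]; simp
    · exact (hval y hy hyx).le
  rw [vertices, mem_exposedPoints_iff_exposed_singleton, isExposed_iff (Set.singleton_nonempty x)]
  refine ⟨Λ, valid_convexHull hv, ?_⟩
  rw [zeroSet_convexHull hv]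
  have : zeroSet s Λ = {x} := by
    ext y
    constructor
    · rintro ⟨hy, hy0⟩
      by_contra hyx
      exact (hval y hy hyx).ne' hy0
    · rintro rfl
      exact ⟨hxs, by rw [hΛ]; simp⟩
  rw [this, convexHull_singleton]

lemma vertices_convexHull_subset (s : Set (E d)) : vertices (convexHull ℝ s) ⊆ s :=
  exposedPoints_subset_extremePoints.trans extremePoints_convexHull_subset

lemma convexHull_vertices {s : Set (E d)} (hs : s.Finite) :
    convexHull ℝ (vertices (convexHull ℝ s)) = convexHull ℝ s := by
  apply Set.Subset.antisymm
  · exact convexHull_mono (vertices_convexHull_subset s)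
  · have h1 := closure_convexHull_extremePoints (hs.isCompact_convexHull ℝ) (convex_convexHull ℝ s)
    have h2 : ((convexHull ℝ s).extremePoints ℝ).Finite :=
      hs.subset extremePoints_convexHull_subset
    rw [(h2.isClosed_convexHull ℝ).closure_eq] at h1
    conv_lhs => rw [← h1]
    exact convexHull_mono fun x hx => mem_vertices_of_extreme hs hx

lemma IsPolytope.vertices_finite {P : Set (E d)} (hP : IsPolytope P) : (vertices P).Finite := by
  obtain ⟨⟨s, hs, rfl⟩, -⟩ := hP
  exact hs.subset (vertices_convexHull_subset s)

lemma IsPolytope.convexHull_vertices {P : Set (E d)} (hP : IsPolytope P) :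
    convexHull ℝ (vertices P) = P := by
  obtain ⟨⟨s, hs, rfl⟩, -⟩ := hP
  exact PolytopeMerge.convexHull_vertices hs

lemma vertices_subset (P : Set (E d)) : vertices P ⊆ P := exposedPoints_subset

/-- A vertex of a set lies in every set of generators of a convex subset that contains it. -/
lemma mem_of_mem_vertices {P s : Set (E d)} {x : E d} (hx : x ∈ vertices P)
    (hs : convexHull ℝ s ⊆ P) (hxs : x ∈ convexHull ℝ s) : x ∈ s :=
  extremePoints_convexHull_subset (inter_extremePoints_subset_extremePoints_of_subset hs
    ⟨hxs, exposedPoints_subset_extremePoints hx⟩)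

/-! ### Projective transformations preserve the face structure -/

/-- The projective transformation with homogeneous form `L` is defined on `P`, with positive
denominator. -/
def PosOn (L : (E d × ℝ) ≃ₗ[ℝ] (E d × ℝ)) (P : Set (E d)) : Prop := ∀ x ∈ P, 0 < projDenom L x

/-- The denominator of a projective transformation as a linear form. -/
def denomForm (L : (E d × ℝ) ≃ₗ[ℝ] (E d × ℝ)) : Form d :=
  LinearMap.snd ℝ (E d) ℝ ∘ₗ L.toLinearMap

lemma denomForm_hom (L : (E d × ℝ) ≃ₗ[ℝ] (E d × ℝ)) (x : E d) :
    denomForm L (hom x) = projDenom L x := rfl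

lemma hom_projMap {L : (E d × ℝ) ≃ₗ[ℝ] (E d × ℝ)} {x : E d} (h : projDenom L x ≠ 0) :
    hom (projMap L x) = (projDenom L x)⁻¹ • L (hom x) := by
  refine Prod.ext rfl ?_
  change (1 : ℝ) = (projDenom L x)⁻¹ * projDenom L x
  rw [inv_mul_cancel₀ h]

lemma symm_hom_projMap {L : (E d × ℝ) ≃ₗ[ℝ] (E d × ℝ)} {x : E d} (h : projDenom L x ≠ 0) :
    L.symm (hom (projMap L x)) = (projDenom L x)⁻¹ • hom x := by
  rw [hom_projMap h, map_smul, L.symm_apply_apply]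

lemma projDenom_symm {L : (E d × ℝ) ≃ₗ[ℝ] (E d × ℝ)} {x : E d} (h : projDenom L x ≠ 0) :
    projDenom L.symm (projMap L x) = (projDenom L x)⁻¹ := by
  change (L.symm (hom (projMap L x))).2 = _
  rw [symm_hom_projMap h]
  simp [hom]

lemma projMap_symm {L : (E d × ℝ) ≃ₗ[ℝ] (E d × ℝ)} {x : E d} (h : projDenom L x ≠ 0) :
    projMap L.symm (projMap L x) = x := by
  change (projDenom L.symm (projMap L x))⁻¹ • (L.symm (hom (projMap L x))).1 = _
  rw [projDenom_symm h, symm_hom_projMap h]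
  simp [hom, smul_smul, h]

lemma PosOn.mono {L : (E d × ℝ) ≃ₗ[ℝ] (E d × ℝ)} {P S : Set (E d)} (h : PosOn L P) (hS : S ⊆ P) :
    PosOn L S := fun x hx => h x (hS hx)

lemma PosOn.symm {L : (E d × ℝ) ≃ₗ[ℝ] (E d × ℝ)} {P : Set (E d)} (h : PosOn L P) :
    PosOn L.symm (projMap L '' P) := by
  rintro _ ⟨x, hx, rfl⟩
  rw [projDenom_symm (h x hx).ne']
  exact inv_pos.2 (h x hx)

lemma PosOn.symm_image {L : (E d × ℝ) ≃ₗ[ℝ] (E d × ℝ)} {P : Set (E d)} (h : PosOn L P) :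
    projMap L.symm '' (projMap L '' P) = P := by
  rw [Set.image_image]
  conv_rhs => rw [← Set.image_id P]
  exact Set.image_congr fun x hx => projMap_symm (h x hx).ne'

lemma PosOn.hull {L : (E d × ℝ) ≃ₗ[ℝ] (E d × ℝ)} {s : Set (E d)} (h : PosOn L s) :
    PosOn L (convexHull ℝ s) :=
  convexHull_min h (convex_form_pos (denomForm L))

lemma PosOn.image_convexHull_subset {L : (E d × ℝ) ≃ₗ[ℝ] (E d × ℝ)} {s : Set (E d)}
    (h : PosOn L s) : projMap L '' (convexHull ℝ s) ⊆ convexHull ℝ (projMap L '' s) := by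
  have key : convexHull ℝ s ⊆
      {x | 0 < projDenom L x ∧ projMap L x ∈ convexHull ℝ (projMap L '' s)} := by
    refine convexHull_min (fun x hx => ⟨h x hx, subset_convexHull ℝ _ ⟨x, hx, rfl⟩⟩) ?_
    rintro x ⟨hx, hx'⟩ y ⟨hy, hy'⟩ p q hp hq hpq
    have hpos : 0 < projDenom L (p • x + q • y) :=
      convex_form_pos (denomForm L) hx hy hp hq hpq
    refine ⟨hpos, ?_⟩
    have hd : projDenom L (p • x + q • y) = p * projDenom L x + q * projDenom L y :=
      form_combo (denomForm L) x y hpq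
    have hL : L (p • x + q • y, 1) = p • L (x, 1) + q • L (y, 1) := by
      rw [← map_smul, ← map_smul, ← map_add]; simp [hpq]
    have e : projMap L (p • x + q • y) =
        (p * projDenom L x / projDenom L (p • x + q • y)) • projMap L x +
        (q * projDenom L y / projDenom L (p • x + q • y)) • projMap L y := by
      unfold projMap
      rw [hL, smul_smul, smul_smul]
      simp only [Prod.fst_add, Prod.smul_fst, smul_add, smul_smul]
      congr 2
      · field_simp
      · field_simp
    rw [e]
    refine convex_convexHull ℝ _ hx' hy' (by positivity) (by positivity) ?_
    rw [← add_div, ← hd, div_self hpos.ne']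
  rintro _ ⟨x, hx, rfl⟩
  exact (key hx).2

/-- A projective transformation with positive denominators maps convex hulls to convex hulls. -/
lemma PosOn.image_convexHull {L : (E d × ℝ) ≃ₗ[ℝ] (E d × ℝ)} {s : Set (E d)} (h : PosOn L s) :
    projMap L '' (convexHull ℝ s) = convexHull ℝ (projMap L '' s) := by
  refine Set.Subset.antisymm h.image_convexHull_subset ?_
  have h1 := h.symm.image_convexHull_subset
  rw [h.symm_image] at h1
  have h2 := Set.image_mono (f := projMap L) h1
  have h3 := h.symm.hull.symm_image
  rw [LinearEquiv.symm_symm] at h3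
  rwa [h3] at h2

lemma PosOn.homSpan_image {L : (E d × ℝ) ≃ₗ[ℝ] (E d × ℝ)} {G : Set (E d)} (h : PosOn L G) :
    homSpan (projMap L '' G) = (homSpan G).map L.toLinearMap := by
  apply le_antisymm
  · refine homSpan_le ?_
    rintro _ ⟨x, hx, rfl⟩
    rw [hom_projMap (h x hx).ne']
    exact Submodule.smul_mem _ _ (Submodule.mem_map_of_mem (hom_mem_homSpan hx))
  · rw [Submodule.map_le_iff_le_comap]
    refine homSpan_le fun x hx => ?_
    have e : L (hom x) = projDenom L x • hom (projMap L x) := by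
      rw [hom_projMap (h x hx).ne', smul_smul, mul_inv_cancel₀ (h x hx).ne', one_smul]
    change L (hom x) ∈ homSpan (projMap L '' G)
    rw [e]
    exact Submodule.smul_mem _ _ (hom_mem_homSpan ⟨x, hx, rfl⟩)

lemma PosOn.finrank_image {L : (E d × ℝ) ≃ₗ[ℝ] (E d × ℝ)} {G : Set (E d)} (h : PosOn L G) :
    Module.finrank ℝ (homSpan (projMap L '' G)) = Module.finrank ℝ (homSpan G) := by
  rw [h.homSpan_image]
  exact L.finrank_map_eq _

lemma PosOn.isPolytope_image {L : (E d × ℝ) ≃ₗ[ℝ] (E d × ℝ)} {P : Set (E d)} (h : PosOn L P)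
    (hP : IsPolytope P) : IsPolytope (projMap L '' P) := by
  have hne := hP.2.1
  have htop := hP.homSpan_eq_top
  obtain ⟨⟨s, hs, rfl⟩, -⟩ := hP
  have hs' : PosOn L s := h.mono (subset_convexHull ℝ s)
  refine ⟨⟨projMap L '' s, hs.image _, hs'.image_convexHull⟩, hne.image _, ?_⟩
  rw [← homSpan_eq_top_iff (hne.image _), h.homSpan_image, htop, Submodule.map_top,
    LinearEquiv.range]

/-- The form `Λ` transported by `L`. -/
def pushForm (L : (E d × ℝ) ≃ₗ[ℝ] (E d × ℝ)) (Λ : Form d) : Form d := Λ ∘ₗ L.symm.toLinearMap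

lemma pushForm_projMap {L : (E d × ℝ) ≃ₗ[ℝ] (E d × ℝ)} (Λ : Form d) {x : E d}
    (h : projDenom L x ≠ 0) :
    pushForm L Λ (hom (projMap L x)) = (projDenom L x)⁻¹ * Λ (hom x) := by
  change Λ (L.symm (hom (projMap L x))) = _
  rw [symm_hom_projMap h, map_smul, smul_eq_mul]

lemma PosOn.valid_push {L : (E d × ℝ) ≃ₗ[ℝ] (E d × ℝ)} {P : Set (E d)} (h : PosOn L P)
    {Λ : Form d} (hv : Valid P Λ) : Valid (projMap L '' P) (pushForm L Λ) := by
  rintro _ ⟨x, hx, rfl⟩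
  rw [pushForm_projMap Λ (h x hx).ne']
  exact mul_nonneg (inv_nonneg.2 (h x hx).le) (hv x hx)

lemma PosOn.image_zeroSet {L : (E d × ℝ) ≃ₗ[ℝ] (E d × ℝ)} {P : Set (E d)} (h : PosOn L P)
    (Λ : Form d) : projMap L '' zeroSet P Λ = zeroSet (projMap L '' P) (pushForm L Λ) := by
  ext y
  constructor
  · rintro ⟨x, ⟨hx, h0⟩, rfl⟩
    exact ⟨⟨x, hx, rfl⟩, by rw [pushForm_projMap Λ (h x hx).ne', h0, mul_zero]⟩
  · rintro ⟨⟨x, hx, rfl⟩, h0⟩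
    rw [pushForm_projMap Λ (h x hx).ne'] at h0
    exact ⟨x, ⟨hx, (mul_eq_zero.1 h0).resolve_left (inv_ne_zero (h x hx).ne')⟩, rfl⟩

lemma PosOn.isFace_image {L : (E d × ℝ) ≃ₗ[ℝ] (E d × ℝ)} {P G : Set (E d)} (h : PosOn L P)
    {k : ℕ} (hG : IsFace P k G) : IsFace (projMap L '' P) k (projMap L '' G) := by
  rw [isFace_iff] at hG ⊢
  obtain ⟨hne, ⟨Λ, hv, rfl⟩, hk⟩ := hG
  exact ⟨hne.image _, ⟨pushForm L Λ, h.valid_push hv, h.image_zeroSet Λ⟩,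
    by rw [(h.mono (zeroSet_subset P Λ)).finrank_image, hk]⟩

lemma PosOn.isFacet_image {L : (E d × ℝ) ≃ₗ[ℝ] (E d × ℝ)} {P H : Set (E d)} (h : PosOn L P)
    (hH : IsFacet P H) : IsFacet (projMap L '' P) (projMap L '' H) := by
  rw [isFacet_iff] at hH ⊢
  obtain ⟨hne, ⟨Λ, hv, rfl⟩, hk⟩ := hH
  exact ⟨hne.image _, ⟨pushForm L Λ, h.valid_push hv, h.image_zeroSet Λ⟩,
    by rw [(h.mono (zeroSet_subset P Λ)).finrank_image, hk]⟩

lemma IsFace.subset {P G : Set (E d)} {k : ℕ} (h : IsFace P k G) : G ⊆ P := h.1.subset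

lemma IsFacet.subset {P G : Set (E d)} (h : IsFacet P G) : G ⊆ P := h.1.subset

lemma PosOn.isSimplex_image {L : (E d × ℝ) ≃ₗ[ℝ] (E d × ℝ)} {G : Set (E d)} (h : PosOn L G)
    {k : ℕ} (hG : IsSimplex k G) : IsSimplex k (projMap L '' G) := by
  obtain ⟨p, hp, rfl⟩ := hG
  have hs : PosOn L (Set.range p) := h.mono (subset_convexHull ℝ _)
  refine ⟨projMap L ∘ p, ?_, by rw [hs.image_convexHull, Set.range_comp]⟩
  rw [affineIndependent_iff_hom] at hp ⊢
  have hpos : ∀ i, 0 < projDenom L (p i) := fun i => hs _ ⟨i, rfl⟩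
  have h1 := (hp.map' L.toLinearMap (LinearEquiv.ker L)).units_smul
    (fun i => (Units.mk0 _ (hpos i).ne')⁻¹)
  have e : (fun i => hom ((projMap L ∘ p) i)) =
      (fun i => (Units.mk0 _ (hpos i).ne')⁻¹) • (⇑L.toLinearMap ∘ fun i => hom (p i)) :=
    funext fun i => hom_projMap (hpos i).ne'
  rw [e]
  exact h1

lemma PosOn.isSimplicial_image {L : (E d × ℝ) ≃ₗ[ℝ] (E d × ℝ)} {P : Set (E d)} (h : PosOn L P)
    {j : ℕ} (hP : IsSimplicial j P) : IsSimplicial j (projMap L '' P) := by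
  intro G hG
  have h1 := h.symm.isFace_image hG
  rw [h.symm_image] at h1
  have h2 := (h.mono h1.subset).isSimplex_image (hP _ h1)
  have h3 := (h.symm.mono hG.subset).symm_image
  rw [LinearEquiv.symm_symm] at h3
  rwa [h3] at h2

lemma PosOn.isSimple_image {L : (E d × ℝ) ≃ₗ[ℝ] (E d × ℝ)} {P : Set (E d)} (h : PosOn L P)
    {i : ℕ} (hP : IsSimple i P) : IsSimple i (projMap L '' P) := by
  intro G hG
  have h1 := h.symm.isFace_image hG
  rw [h.symm_image] at h1
  rw [← hP _ h1]
  have hback : ∀ S, S ⊆ projMap L '' P → projMap L '' (projMap L.symm '' S) = S := by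
    intro S hS
    have h3 := (h.symm.mono hS).symm_image
    rwa [LinearEquiv.symm_symm] at h3
  symm
  refine Set.ncard_congr (fun H _ => projMap L '' H) ?_ ?_ ?_
  · rintro H ⟨hH, hGH⟩
    refine ⟨h.isFacet_image hH, ?_⟩
    rw [← hback G hG.subset]
    exact Set.image_mono hGH
  · rintro H H' ⟨hH, -⟩ ⟨hH', -⟩ e
    rw [← (h.mono hH.subset).symm_image, ← (h.mono hH'.subset).symm_image]
    exact congrArg _ e
  · rintro H ⟨hH, hGH⟩
    refine ⟨projMap L.symm '' H, ⟨?_, Set.image_mono hGH⟩, hback H hH.subset⟩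
    have := h.symm.isFacet_image hH
    rwa [h.symm_image] at this

/-- On a convex set the denominator has constant sign, so it can be made positive by changing the
sign of the homogeneous form. -/
lemma exists_posOn {L : (E d × ℝ) ≃ₗ[ℝ] (E d × ℝ)} {P : Set (E d)} (hP : Convex ℝ P)
    (h : ∀ x ∈ P, projDenom L x ≠ 0) :
    ∃ L' : (E d × ℝ) ≃ₗ[ℝ] (E d × ℝ), PosOn L' P ∧ projMap L' = projMap L := by
  by_cases hpos : PosOn L P
  · exact ⟨L, hpos, rfl⟩
  have hneg : ∀ x, projDenom (L.trans (LinearEquiv.neg ℝ)) x = - projDenom L x := fun x => rfl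
  refine ⟨L.trans (LinearEquiv.neg ℝ), ?_, ?_⟩
  · unfold PosOn at hpos
    push Not at hpos
    obtain ⟨y, hy, hy0⟩ := hpos
    have hy1 : projDenom L y < 0 := lt_of_le_of_ne hy0 (h y hy)
    intro x hx
    rw [hneg]
    by_contra hcon
    have hx1 : 0 < projDenom L x := lt_of_le_of_ne (by linarith) (h x hx).symm
    -- the denominator vanishes at a point of the segment from `x` to `y`
    have hd : 0 < projDenom L x - projDenom L y := by linarith
    have hpq : -projDenom L y / (projDenom L x - projDenom L y) +
        projDenom L x / (projDenom L x - projDenom L y) = 1 := by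
      field_simp; ring
    refine h _ (hP hx hy (div_nonneg (by linarith) hd.le) (div_nonneg hx1.le hd.le) hpq) ?_
    have := form_combo (denomForm L) x y hpq
    simp only [denomForm_hom] at this
    rw [this]
    field_simp; ring
  · funext x
    unfold projMap
    rw [hneg, inv_neg]
    change -(projDenom L x)⁻¹ • -(L (x, 1)).1 = _
    simp

/-! ### Affine transformations as projective transformations -/

/-- The homogeneous form of an affine transformation. -/
noncomputable def affineForm (S : E d ≃ᵃ[ℝ] E d) : (E d × ℝ) ≃ₗ[ℝ] (E d × ℝ) where
  toFun y := (S.linear y.1 + y.2 • S 0, y.2)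
  invFun y := (S.linear.symm (y.1 - y.2 • S 0), y.2)
  map_add' x y := by ext1 <;> simp [add_smul]; abel
  map_smul' c x := by ext1 <;> simp [smul_smul]
  left_inv y := by simp
  right_inv y := by simp

lemma affineForm_hom (S : E d ≃ᵃ[ℝ] E d) (x : E d) : affineForm S (hom x) = hom (S x) := by
  have h := S.map_vadd 0 x
  simp only [vadd_eq_add, add_zero] at h
  refine Prod.ext ?_ rfl
  change S.linear x + (1 : ℝ) • S 0 = S x
  rw [h, one_smul]

lemma projDenom_affineForm (S : E d ≃ᵃ[ℝ] E d) (x : E d) : projDenom (affineForm S) x = 1 := rfl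

lemma projMap_affineForm (S : E d ≃ᵃ[ℝ] E d) : projMap (affineForm S) = S := by
  funext x
  have h := affineForm_hom S x
  change (projDenom (affineForm S) x)⁻¹ • (affineForm S (hom x)).1 = _
  rw [projDenom_affineForm, h]
  simp [hom]

lemma posOn_affineForm (S : E d ≃ᵃ[ℝ] E d) (P : Set (E d)) : PosOn (affineForm S) P :=
  fun _ _ => one_pos

lemma projDenom_trans_affineForm (L : (E d × ℝ) ≃ₗ[ℝ] (E d × ℝ)) (S : E d ≃ᵃ[ℝ] E d) (x : E d) :
    projDenom (L.trans (affineForm S)) x = projDenom L x := rfl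

lemma projMap_trans_affineForm {L : (E d × ℝ) ≃ₗ[ℝ] (E d × ℝ)} (S : E d ≃ᵃ[ℝ] E d) {x : E d}
    (h : projDenom L x ≠ 0) : projMap (L.trans (affineForm S)) x = S (projMap L x) := by
  apply hom_injective
  rw [hom_projMap (by rwa [projDenom_trans_affineForm]), projDenom_trans_affineForm,
    ← affineForm_hom, hom_projMap h, map_smul]
  rfl

lemma vertices_image (S : E d ≃ᵃ[ℝ] E d) (P : Set (E d)) : vertices (S '' P) = S '' vertices P := by
  have key : ∀ (S : E d ≃ᵃ[ℝ] E d) (P : Set (E d)) (x : E d), x ∈ vertices P →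
      S x ∈ vertices (S '' P) := by
    intro S P x hx
    rw [vertices, mem_exposedPoints_iff_exposed_singleton,
      isExposed_iff (Set.singleton_nonempty _)] at hx ⊢
    obtain ⟨Λ, hv, hz⟩ := hx
    refine ⟨pushForm (affineForm S) Λ, ?_, ?_⟩
    · have := (posOn_affineForm S P).valid_push hv
      rwa [projMap_affineForm] at this
    · have := (posOn_affineForm S P).image_zeroSet Λ
      rwa [projMap_affineForm, ← hz, Set.image_singleton] at this
  apply Set.Subset.antisymm
  · intro y hy
    have := key S.symm _ y hy
    rw [Set.image_image] at this
    simp only [AffineEquiv.symm_apply_apply, Set.image_id'] at this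
    exact ⟨_, this, by simp⟩
  · rintro _ ⟨x, hx, rfl⟩
    exact key S P x hx

/-! ### Facets through a given face -/

lemma finrank_homSpan_zeroSet_le (P : Set (E d)) {Λ : Form d} (hΛ : Λ ≠ 0) :
    Module.finrank ℝ (homSpan (zeroSet P Λ)) ≤ d := by
  have h1 : homSpan (zeroSet P Λ) ≤ LinearMap.ker Λ := homSpan_le fun x hx => hx.2
  have h2 : LinearMap.ker Λ < ⊤ := lt_top_iff_ne_top.2 fun h => hΛ (LinearMap.ker_eq_top.1 h)
  have h3 := Submodule.finrank_lt_finrank_of_lt h2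
  rw [finrank_top, finrank_hom] at h3
  have h4 := Submodule.finrank_mono h1
  omega

lemma sup_span_eq_top {W : Submodule ℝ (E d × ℝ)} (hW : d ≤ Module.finrank ℝ W) {y : E d × ℝ}
    (hy : y ∉ W) : W ⊔ Submodule.span ℝ {y} = ⊤ := by
  have hlt : W < W ⊔ Submodule.span ℝ {y} := by
    refine lt_of_le_of_ne le_sup_left fun h => hy ?_
    rw [h]
    exact Submodule.mem_sup_right (Submodule.mem_span_singleton_self y)
  have h1 := Submodule.finrank_lt_finrank_of_lt hlt
  have h2 := Submodule.finrank_le (W ⊔ Submodule.span ℝ {y})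
  apply Submodule.eq_top_of_finrank_eq
  rw [finrank_hom] at *
  omega

lemma exists_min_ratio {s : Set (E d)} (hs : s.Finite) (A B : Form d)
    (h : ∃ w ∈ s, 0 < B (hom w)) :
    ∃ w ∈ s, 0 < B (hom w) ∧
      ∀ x ∈ s, 0 < B (hom x) → A (hom w) / B (hom w) * B (hom x) ≤ A (hom x) := by
  obtain ⟨w, ⟨hw1, hw2⟩, hw⟩ := Set.exists_min_image {w | w ∈ s ∧ 0 < B (hom w)}
    (fun w => A (hom w) / B (hom w)) (hs.subset fun _ h => h.1) (by
      obtain ⟨w, h1, h2⟩ := h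
      exact ⟨w, h1, h2⟩)
  refine ⟨w, hw1, hw2, fun x hx hx0 => ?_⟩
  have := hw x ⟨hx, hx0⟩
  rwa [le_div_iff₀ hx0] at this

/-- If an affine function that is nonnegative on a polytope is negative at `u`, then its zero set
lies in a facet whose hyperplane strictly separates `u` from the polytope. A form with a zero set of
maximal rank does it: if that rank were too small, the form could be tilted, keeping its values on
its zero set and at `u`, until it vanishes at one more vertex. -/
lemma exists_facet_form {s : Set (E d)} (hs : s.Finite) (htop : homSpan s = ⊤) {u : E d}
    {Λ : Form d} (hv : Valid s Λ) (hu : Λ (hom u) < 0) :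
    ∃ Λ' : Form d, Valid s Λ' ∧ zeroSet s Λ ⊆ zeroSet s Λ' ∧ Λ' (hom u) < 0 ∧
      Module.finrank ℝ (homSpan (zeroSet s Λ')) = d := by
  induction hn : d - Module.finrank ℝ (homSpan (zeroSet s Λ)) using Nat.strong_induction_on
    generalizing Λ with
  | _ n ih =>
  have hΛ : Λ ≠ 0 := by rintro rfl; simp at hu
  have hle := finrank_homSpan_zeroSet_le s hΛ
  rcases hle.eq_or_lt with heq | hlt
  · exact ⟨Λ, hv, le_rfl, hu, heq⟩
  have hW : homSpan (zeroSet s Λ) ⊔ Submodule.span ℝ {hom u} < ⊤ := by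
    refine lt_top_iff_ne_top.2 fun h => ?_
    have h1 := Submodule.finrank_add_le_finrank_add_finrank (homSpan (zeroSet s Λ))
      (Submodule.span ℝ {hom u})
    rw [h, finrank_top, finrank_hom, finrank_span_singleton (hom_ne_zero u)] at h1
    omega
  obtain ⟨M₀, hM₀, hker₀⟩ := Submodule.exists_le_ker_of_lt_top _ hW
  -- choose the sign of the tilting direction
  obtain ⟨M, hker, hMpos⟩ : ∃ M : Form d,
      homSpan (zeroSet s Λ) ⊔ Submodule.span ℝ {hom u} ≤ LinearMap.ker M ∧
      ∃ w ∈ s, 0 < M (hom w) := by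
    obtain ⟨w, hw, hw0⟩ : ∃ w ∈ s, M₀ (hom w) ≠ 0 := by
      by_contra! hcon
      exact hM₀ (form_eq_zero htop hcon)
    rcases lt_or_gt_of_ne hw0 with h | h
    · exact ⟨-M₀, fun y hy => by simpa using hker₀ hy, w, hw, by simpa using h⟩
    · exact ⟨M₀, hker₀, w, hw, h⟩
  have hMu : M (hom u) = 0 :=
    hker (Submodule.mem_sup_right (Submodule.mem_span_singleton_self _))
  have hMz : ∀ x ∈ zeroSet s Λ, M (hom x) = 0 := fun x hx =>
    hker (Submodule.mem_sup_left (hom_mem_homSpan hx))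
  obtain ⟨w, hws, hwpos, hmin⟩ := exists_min_ratio hs Λ M hMpos
  set t := Λ (hom w) / M (hom w) with ht
  have ht0 : 0 ≤ t := div_nonneg (hv w hws) hwpos.le
  have hev : ∀ x, (Λ - t • M) (hom x) = Λ (hom x) - t * M (hom x) := fun x => by simp
  have hv' : Valid s (Λ - t • M) := by
    intro x hx
    rw [hev]
    by_cases hx0 : 0 < M (hom x)
    · linarith [hmin x hx hx0]
    · have := mul_nonneg ht0 (neg_nonneg.2 (not_lt.1 hx0))
      have := hv x hx
      linarith
  have hsub : zeroSet s Λ ⊆ zeroSet s (Λ - t • M) := by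
    intro x hx
    exact ⟨hx.1, by rw [hev, hx.2, hMz x hx]; simp⟩
  have hwz : w ∈ zeroSet s (Λ - t • M) := ⟨hws, by rw [hev, ht]; field_simp; ring⟩
  have hwn : hom w ∉ homSpan (zeroSet s Λ) := fun h =>
    hwpos.ne' (eq_zero_of_mem_homSpan hMz h)
  have hu' : (Λ - t • M) (hom u) < 0 := by rw [hev, hMu]; simpa using hu
  have hlt' : homSpan (zeroSet s Λ) < homSpan (zeroSet s (Λ - t • M)) := by
    refine lt_of_le_of_ne (homSpan_mono hsub) fun h => hwn ?_
    rw [h]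
    exact hom_mem_homSpan hwz
  have hrank := Submodule.finrank_lt_finrank_of_lt hlt'
  obtain ⟨Λ', h1, h2, h3, h4⟩ := ih _ (by omega) hv' hu' rfl
  exact ⟨Λ', h1, hsub.trans h2, h3, h4⟩

lemma exists_dual_one {ι : Type*} {p : ι → E d × ℝ} (hp : LinearIndependent ℝ p) (k : ι) :
    ∃ X : Form d, X (p k) = 1 ∧ ∀ m, m ≠ k → X (p m) = 0 := by
  have hnot : p k ∉ Submodule.span ℝ (p '' {k}ᶜ) := hp.notMem_span_image (by simp)
  obtain ⟨f, hf, hmap⟩ := Submodule.exists_dual_map_eq_bot_of_notMem hnot inferInstance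
  refine ⟨(f (p k))⁻¹ • f, by simp [hf], fun m hm => ?_⟩
  have : f (p m) ∈ (Submodule.span ℝ (p '' {k}ᶜ)).map f :=
    Submodule.mem_map_of_mem (Submodule.subset_span ⟨m, hm, rfl⟩)
  rw [hmap, Submodule.mem_bot] at this
  simp [this]

/-- Beyond each ridge of a simplex facet there is exactly one other facet. Its affine function is
found by rotating a hyperplane about the ridge until it meets a further vertex; the pencil of affine
functions that vanish on the ridge is spanned by this function and that of the simplex facet. -/
lemma exists_adjacent_form {P : Set (E d)} (hP : IsPolytope P) {a : Fin d → E d}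
    (ha : IsSimplexFacet P a) (k : Fin d) :
    ∃ Λ : Form d, Valid P Λ ∧ Λ (hom (a k)) = 1 ∧ (∀ m, m ≠ k → Λ (hom (a m)) = 0) ∧
      Module.finrank ℝ (homSpan (zeroSet P Λ)) = d ∧
      ∀ H, IsAdjacentFacet P a k H → H = zeroSet P Λ := by
  obtain ⟨hind, hfac⟩ := ha
  rw [affineIndependent_iff_hom] at hind
  obtain ⟨-, ⟨Λ₀, hv₀, hF⟩, hrF⟩ := isFacet_iff.1 hfac
  have htop := hP.homSpan_eq_top
  have hPfin := hP.vertices_finite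
  have hPconv := hP.convexHull_vertices
  set s := vertices P with hs
  have hsP : s ⊆ P := vertices_subset P
  have htops : homSpan s = ⊤ := by rw [← homSpan_convexHull, hPconv, htop]
  have haF : ∀ m, a m ∈ zeroSet P Λ₀ := fun m => hF ▸ subset_convexHull ℝ _ ⟨m, rfl⟩
  obtain ⟨X, hX1, hX0⟩ := exists_dual_one hind k
  have hXF : Valid (zeroSet P Λ₀) X := by
    rw [← hF]
    apply valid_convexHull
    rintro _ ⟨m, rfl⟩
    by_cases hm : m = k
    · subst hm; simp [hX1]
    · exact (hX0 m hm).ge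
  have hΛ₀ : Λ₀ ≠ 0 := by
    rintro rfl
    have : zeroSet P 0 = P := by ext x; simp [zeroSet]
    rw [hF, this, htop, finrank_top, finrank_hom] at hrF
    omega
  have hpos : ∃ w ∈ s, 0 < Λ₀ (hom w) := by
    by_contra! hcon
    exact hΛ₀ (form_eq_zero htops fun x hx => le_antisymm (hcon x hx) (hv₀ x (hsP hx)))
  obtain ⟨w, hws, hw, hmin⟩ := exists_min_ratio hPfin X Λ₀ hpos
  set t := X (hom w) / Λ₀ (hom w) with ht
  have hev : ∀ x, (X - t • Λ₀) (hom x) = X (hom x) - t * Λ₀ (hom x) := fun x => by simp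
  have hv : Valid P (X - t • Λ₀) := by
    rw [← hPconv]
    apply valid_convexHull
    intro x hx
    rw [hev]
    rcases (hv₀ x (hsP hx)).eq_or_lt with h0 | h0
    · rw [← h0]; simpa using hXF x ⟨hsP hx, h0.symm⟩
    · linarith [hmin x hx h0]
  have hk1 : (X - t • Λ₀) (hom (a k)) = 1 := by rw [hev, (haF k).2, hX1]; simp
  have hk0 : ∀ m, m ≠ k → (X - t • Λ₀) (hom (a m)) = 0 := fun m hm => by
    rw [hev, (haF m).2, hX0 m hm]; simp
  have hw0 : (X - t • Λ₀) (hom w) = 0 := by rw [hev, ht]; field_simp; ring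
  have hspan : Submodule.span ℝ (Set.range fun m => hom (a m)) ⊔ Submodule.span ℝ {hom w} = ⊤ := by
    apply sup_span_eq_top
    · rw [finrank_span_eq_card hind]; simp
    · intro h
      have : Submodule.span ℝ (Set.range fun m => hom (a m)) ≤ LinearMap.ker Λ₀ := by
        rw [Submodule.span_le]
        rintro _ ⟨m, rfl⟩
        exact (haF m).2
      exact hw.ne' (this h)
  have hrank : Module.finrank ℝ (homSpan (zeroSet P (X - t • Λ₀))) = d := by
    apply le_antisymm
    · apply finrank_homSpan_zeroSet_le
      intro h
      rw [h] at hk1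
      simp at hk1
    · have h1 : homSpan (zeroSet P (X - t • Λ₀)) ⊔ Submodule.span ℝ {hom (a k)} = ⊤ := by
        rw [eq_top_iff, ← hspan]
        refine sup_le ?_ ?_
        · rw [Submodule.span_le]
          rintro _ ⟨m, rfl⟩
          by_cases hm : m = k
          · subst hm
            exact Submodule.mem_sup_right (Submodule.mem_span_singleton_self _)
          · exact Submodule.mem_sup_left (hom_mem_homSpan ⟨(haF m).1, hk0 m hm⟩)
        · rw [Submodule.span_singleton_le_iff_mem]
          exact Submodule.mem_sup_left (hom_mem_homSpan ⟨hsP hws, hw0⟩)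
      have h2 := Submodule.finrank_add_le_finrank_add_finrank
        (homSpan (zeroSet P (X - t • Λ₀))) (Submodule.span ℝ {hom (a k)})
      rw [h1, finrank_top, finrank_hom, finrank_span_singleton (hom_ne_zero _)] at h2
      omega
  refine ⟨X - t • Λ₀, hv, hk1, hk0, hrank, ?_⟩
  rintro H ⟨hH, hHF, hHk⟩
  obtain ⟨-, ⟨M, hvM, rfl⟩, hrM⟩ := isFacet_iff.1 hH
  set Λ := X - t • Λ₀ with hΛ
  have hMk : ∀ m, m ≠ k → M (hom (a m)) = 0 := fun m hm =>
    (hHk (subset_convexHull ℝ _ ⟨m, hm, rfl⟩)).2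
  set α := M (hom (a k)) with hα
  set γ := M (hom w) / Λ₀ (hom w) with hγ
  have hα0 : 0 ≤ α := hvM _ (haF k).1
  have hγ0 : 0 ≤ γ := div_nonneg (hvM _ (hsP hws)) hw.le
  -- `M` lies in the pencil
  have hM : M = α • Λ + γ • Λ₀ := by
    have hker : (⊤ : Submodule ℝ (E d × ℝ)) ≤ LinearMap.ker (M - (α • Λ + γ • Λ₀)) := by
      rw [← hspan]
      refine sup_le ?_ ?_
      · rw [Submodule.span_le]
        rintro _ ⟨m, rfl⟩
        simp only [SetLike.mem_coe, LinearMap.mem_ker, LinearMap.sub_apply, LinearMap.add_apply,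
          LinearMap.smul_apply, smul_eq_mul]
        rw [(haF m).2]
        by_cases hm : m = k
        · subst hm; rw [hk1, ← hα]; ring
        · rw [hk0 m hm, hMk m hm]; ring
      · rw [Submodule.span_singleton_le_iff_mem]
        simp only [LinearMap.mem_ker, LinearMap.sub_apply, LinearMap.add_apply,
          LinearMap.smul_apply, smul_eq_mul]
        rw [hw0, hγ]
        field_simp
        ring
    exact sub_eq_zero.1 (LinearMap.ker_eq_top.1 (top_le_iff.1 hker))
  have hMev : ∀ x, M (hom x) = α * Λ (hom x) + γ * Λ₀ (hom x) := fun x => by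
    conv_lhs => rw [hM]
    simp
  have hγz : γ = 0 := by
    by_contra hne
    have hγpos : 0 < γ := lt_of_le_of_ne hγ0 (Ne.symm hne)
    apply hHF
    have hsub : zeroSet P M ⊆ zeroSet P Λ₀ := by
      rintro x ⟨hx, hx0⟩
      rw [hMev] at hx0
      have h1 := mul_nonneg hα0 (hv x hx)
      have h2 := mul_nonneg hγ0 (hv₀ x hx)
      exact ⟨hx, (mul_eq_zero.1 (by linarith : γ * Λ₀ (hom x) = 0)).resolve_left hne⟩
    have heq : homSpan (zeroSet P M) = homSpan (zeroSet P Λ₀) :=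
      Submodule.eq_of_le_of_finrank_eq (homSpan_mono hsub) (by rw [hrM, ← hF, hrF])
    rw [hF]
    refine hsub.antisymm fun x hx => ⟨hx.1, ?_⟩
    exact eq_zero_of_mem_homSpan (S := zeroSet P M) (fun y hy => hy.2)
      (heq ▸ hom_mem_homSpan hx)
  have hαne : α ≠ 0 := by
    intro h
    have hM0 : M = 0 := by rw [hM, h, hγz]; simp
    have : zeroSet P M = P := by ext x; simp [zeroSet, hM0]
    rw [this, htop, finrank_top, finrank_hom] at hrM
    omega
  ext x
  simp only [zeroSet, Set.mem_ofPred_eq, hMev, hγz, zero_mul, add_zero, mul_eq_zero, hαne, false_or]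

/-! ### The cone at a vertex -/

lemma isFace_segment {P : Set (E d)} {v w : E d} (hvw : v ≠ w) {Λ : Form d} (hv : Valid P Λ)
    (h : zeroSet P Λ = segment ℝ v w) : IsFace P 1 (segment ℝ v w) := by
  rw [isFace_iff]
  refine ⟨⟨v, left_mem_segment ℝ v w⟩, ⟨Λ, hv, h.symm⟩, ?_⟩
  rw [← convexHull_pair, homSpan_convexHull, ← dim_add_one (Set.insert_nonempty _ _), dim,
    vectorSpan_pair_rev, finrank_span_singleton (by simpa [sub_eq_zero] using hvw.symm)]

/-- A polytope is contained in the cone with apex `v` spanned by the edges at `v`, and so in every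
convex cone that contains the edge directions. The edges are the vertices of a vertex figure at
`v`. -/
lemma sub_mem_of_neighbors {P : Set (E d)} (hP : IsPolytope P) {v : E d} (hv : v ∈ vertices P)
    {K : Set (E d)} (hK : Convex ℝ K) (hsm : ∀ r : ℝ, 0 ≤ r → ∀ y ∈ K, r • y ∈ K)
    (h0 : (0 : E d) ∈ K) (hnb : ∀ w ∈ neighbors P v, w - v ∈ K) : ∀ x ∈ P, x - v ∈ K := by
  have hfin := hP.vertices_finite
  have hPconv := hP.convexHull_vertices
  obtain ⟨f, hf, hfz⟩ := (isExposed_iff (Set.singleton_nonempty v)).1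
    (mem_exposedPoints_iff_exposed_singleton.1 hv)
  have hfv : f (hom v) = 0 := (hfz ▸ Set.mem_singleton v : v ∈ zeroSet P f).2
  have hfpos : ∀ x ∈ vertices P, x ≠ v → 0 < f (hom x) := by
    intro x hx hxv
    refine lt_of_le_of_ne (hf x (vertices_subset P hx)) fun h => hxv ?_
    have : x ∈ zeroSet P f := ⟨vertices_subset P hx, h.symm⟩
    rwa [← hfz] at this
  let z : E d → E d := fun x => (f (hom x))⁻¹ • (x - v)
  -- distinct vertices have distinct directions
  have hzaux : ∀ x ∈ vertices P, ∀ y ∈ vertices P, x ≠ v → y ≠ v → z x = z y →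
      f (hom x) ≤ f (hom y) → x = y := by
    intro x hx y hy hxv hyv hxy hle
    have hfx := hfpos x hx hxv
    have hfy := hfpos y hy hyv
    have hseg : x ∈ convexHull ℝ {v, y} := by
      rw [convexHull_pair, segment_eq_image']
      refine ⟨f (hom x) / f (hom y), ⟨by positivity, (div_le_one hfy).2 hle⟩, ?_⟩
      have e : x - v = f (hom x) • z y := by
        rw [← hxy]; simp [z, smul_smul, hfx.ne']
      have : (f (hom x) / f (hom y)) • (y - v) = x - v := by
        rw [e]; simp only [z, smul_smul, div_eq_mul_inv]
      simp only
      rw [this]; abel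
    have hsub : convexHull ℝ {v, y} ⊆ P := by
      refine convexHull_min ?_ hP.convex
      rintro _ (rfl | rfl)
      · exact vertices_subset P hv
      · exact vertices_subset P hy
    rcases mem_of_mem_vertices hx hsub hseg with h | h
    · exact absurd h hxv
    · exact h
  have hz : ∀ x ∈ vertices P, ∀ y ∈ vertices P, x ≠ v → y ≠ v → z x = z y → x = y := by
    intro x hx y hy hxv hyv hxy
    rcases le_total (f (hom x)) (f (hom y)) with h | h
    · exact hzaux x hx y hy hxv hyv hxy h
    · exact (hzaux y hy x hx hyv hxv hxy.symm h).symm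
  have hZfin : (z '' (vertices P \ {v})).Finite := (hfin.subset Set.sdiff_subset).image z
  have hvertex : vertices (convexHull ℝ (z '' (vertices P \ {v}))) ⊆ K := by
    intro y hy
    obtain ⟨w, ⟨hw, hwv⟩, rfl⟩ := vertices_convexHull_subset _ hy
    have hwv : w ≠ v := hwv
    obtain ⟨Λ, hΛ, hΛz⟩ := (isExposed_iff (Set.singleton_nonempty _)).1
      (mem_exposedPoints_iff_exposed_singleton.1 hy)
    let Λ' : Form d := Λ ∘ₗ LinearMap.prod
      (LinearMap.fst ℝ (E d) ℝ - (LinearMap.toSpanSingleton ℝ (E d) v) ∘ₗ LinearMap.snd ℝ (E d) ℝ) f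
    have hΛ' : ∀ x, Λ' (hom x) = Λ (x - v, f (hom x)) := fun x => by simp [Λ', hom]
    have hΛ'v : Λ' (hom v) = 0 := by rw [hΛ', hfv, sub_self]; exact map_zero Λ
    have hΛ'x : ∀ x ∈ vertices P, x ≠ v → Λ' (hom x) = f (hom x) * Λ (hom (z x)) := by
      intro x hx hxv
      have hfx := (hfpos x hx hxv).ne'
      have : ((x - v, f (hom x)) : E d × ℝ) = f (hom x) • hom (z x) := by
        refine Prod.ext ?_ (mul_one _).symm
        change x - v = f (hom x) • (f (hom x))⁻¹ • (x - v)
        rw [smul_smul, mul_inv_cancel₀ hfx, one_smul]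
      rw [hΛ', this, map_smul, smul_eq_mul]
    have hmem : ∀ x ∈ vertices P, x ≠ v → z x ∈ convexHull ℝ (z '' (vertices P \ {v})) :=
      fun x hx hxv => subset_convexHull ℝ _ ⟨x, ⟨hx, hxv⟩, rfl⟩
    have hval : Valid (vertices P) Λ' := by
      intro x hx
      by_cases hxv : x = v
      · rw [hxv, hΛ'v]
      · rw [hΛ'x x hx hxv]
        exact mul_nonneg (hfpos x hx hxv).le (hΛ _ (hmem x hx hxv))
    have hzero : zeroSet (vertices P) Λ' = {v, w} := by
      ext x
      constructor
      · rintro ⟨hx, hx0⟩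
        by_cases hxv : x = v
        · exact Or.inl hxv
        · right
          rw [hΛ'x x hx hxv] at hx0
          have h1 := (mul_eq_zero.1 hx0).resolve_left (hfpos x hx hxv).ne'
          have h2 : z x ∈ zeroSet _ Λ := ⟨hmem x hx hxv, h1⟩
          rw [← hΛz] at h2
          exact hz x hx w hw hxv hwv h2
      · rintro (rfl | rfl)
        · exact ⟨hv, hΛ'v⟩
        · refine ⟨hw, ?_⟩
          rw [hΛ'x _ hw hwv]
          have : z x ∈ zeroSet _ Λ := hΛz ▸ Set.mem_singleton _
          rw [this.2, mul_zero]
    have hval' : Valid P Λ' := hPconv ▸ valid_convexHull hval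
    have hface : zeroSet P Λ' = segment ℝ v w := by
      rw [← convexHull_pair, ← hzero, ← zeroSet_convexHull hval, hPconv]
    exact hsm _ (inv_nonneg.2 (hfpos w hw hwv).le) _
      (hnb w ⟨hw, hwv, isFace_segment hwv.symm hval' hface⟩)
  have hZK : convexHull ℝ (z '' (vertices P \ {v})) ⊆ K := by
    rw [← convexHull_vertices hZfin]
    exact convexHull_min hvertex hK
  have hPK : P ⊆ (fun x => x + -v) ⁻¹' K := by
    rw [← hPconv]
    refine convexHull_min (fun x hx => ?_) (hK.translate_preimage_left (-v))
    change x + -v ∈ K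
    rw [← sub_eq_add_neg]
    by_cases hxv : x = v
    · rw [hxv, sub_self]; exact h0
    · have h1 : z x ∈ K := hZK (subset_convexHull ℝ _ ⟨x, ⟨hx, hxv⟩, rfl⟩)
      have h2 : x - v = f (hom x) • z x := by
        simp [z, smul_smul, (hfpos x hx hxv).ne']
      rw [h2]
      exact hsm _ (hfpos x hx hxv).le _ h1
  intro x hx
  rw [sub_eq_add_neg]
  exact hPK hx

/-! ### Standard coordinates -/

/-- The `k`-th unit vector. -/
noncomputable def unitVec (k : Fin d) : E d := EuclideanSpace.single k 1

/-- The sum of the coordinates of a point. -/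
noncomputable def height (x : E d) : ℝ := ∑ k, x k

/-- The `k`-th coordinate as a form. -/
noncomputable def coordForm (k : Fin d) : Form d :=
  (EuclideanSpace.proj k : E d →L[ℝ] ℝ).toLinearMap ∘ₗ LinearMap.fst ℝ (E d) ℝ

/-- The form `1 - height`, nonnegative on the side of the origin. -/
noncomputable def depthForm : Form d := LinearMap.snd ℝ (E d) ℝ - ∑ k, coordForm k

@[simp] lemma coordForm_hom (k : Fin d) (x : E d) : coordForm k (hom x) = x k := rfl

@[simp] lemma depthForm_hom (x : E d) : depthForm (hom x) = 1 - height x := by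
  simp only [depthForm, LinearMap.sub_apply, LinearMap.sum_apply, coordForm_hom]
  rfl

lemma unitVec_apply (k m : Fin d) : unitVec k m = if m = k then 1 else 0 := by
  simp [unitVec]

@[simp] lemma unitVec_self (k : Fin d) : unitVec k k = 1 := by simp [unitVec_apply]

lemma unitVec_of_ne {k m : Fin d} (h : m ≠ k) : unitVec k m = 0 := by simp [unitVec_apply, h]

@[simp] lemma height_unitVec (k : Fin d) : height (unitVec k) = 1 := by
  simp [height, unitVec_apply]

@[simp] lemma height_zero : height (0 : E d) = 0 := by simp [height]

lemma sum_smul_unitVec (x : E d) : ∑ k, x k • unitVec k = x := by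
  ext m
  simp [unitVec_apply]

lemma hom_eq (x : E d) :
    hom x = (1 - height x) • hom 0 + ∑ k, x k • hom (unitVec k) := by
  refine Prod.ext ?_ ?_
  · simp [hom, Prod.fst_sum, sum_smul_unitVec]
  · simp [hom, Prod.snd_sum, height]

/-- Affine functions in barycentric coordinates with respect to the standard simplex. -/
lemma form_eq (Λ : Form d) (x : E d) :
    Λ (hom x) = Λ (hom 0) * (1 - height x) + ∑ k, x k * Λ (hom (unitVec k)) := by
  conv_lhs => rw [hom_eq x]
  simp [mul_comm]

lemma mem_of_height_le_one {S : Set (E d)} (hS : Convex ℝ S) (h0 : (0 : E d) ∈ S)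
    (hu : ∀ k, unitVec k ∈ S) {x : E d} (hx : ∀ k, 0 ≤ x k) (h1 : height x ≤ 1) : x ∈ S := by
  have h := hS.sum_mem (t := Finset.univ) (w := fun o : Option (Fin d) => o.elim (1 - height x) x)
    (z := fun o => o.elim 0 unitVec) (by
      rintro (_ | k) -
      · simpa using h1
      · exact hx k) (by simp [Fintype.sum_option, height]) (by
      rintro (_ | k) -
      · exact h0
      · exact hu k)
  simpa [Fintype.sum_option, sum_smul_unitVec] using h

lemma mem_of_height_eq_one {S : Set (E d)} (hS : Convex ℝ S)
    (hu : ∀ k, unitVec k ∈ S) {x : E d} (hx : ∀ k, 0 ≤ x k) (h1 : height x = 1) : x ∈ S := by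
  have h := hS.sum_mem (t := Finset.univ) (w := x) (z := unitVec)
    (fun k _ => hx k) h1 (fun k _ => hu k)
  rwa [sum_smul_unitVec] at h

lemma linearIndependent_hom_option :
    LinearIndependent ℝ (fun o : Option (Fin d) => hom (o.elim 0 unitVec)) := by
  rw [Fintype.linearIndependent_iff]
  intro g hg
  rw [Fintype.sum_option] at hg
  have h1 : ∀ k, g (some k) = 0 := by
    intro k
    have h := congrArg (coordForm k) hg
    simpa [unitVec_apply] using h
  have h2 := congrArg depthForm hg
  simp only [map_add, map_smul, map_sum, Option.elim_none, Option.elim_some, depthForm_hom,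
    height_zero, height_unitVec, map_zero] at h2
  rintro (_ | k)
  · simpa using h2
  · exact h1 k

/-- The unit vectors outside `K`. -/
def unitSet (K : Finset (Fin d)) : Set (E d) := unitVec '' {k | k ∉ K}

lemma finrank_unitSet (K : Finset (Fin d)) :
    Module.finrank ℝ (homSpan (unitSet K)) + K.card = d := by
  have hli : LinearIndependent ℝ (fun k : {k // k ∉ K} => hom (unitVec k.1)) :=
    linearIndependent_hom_option.comp (fun k : {k // k ∉ K} => some k.1)
      (fun a b h => Subtype.ext (Option.some_injective _ h))
  have h := finrank_span_eq_card hli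
  have hr : Set.range (fun k : {k // k ∉ K} => hom (unitVec k.1)) = hom '' unitSet K := by
    ext y; simp [unitSet]
  rw [hr] at h
  have hc : Fintype.card {k // k ∉ K} = d - K.card := by
    simp [Fintype.card_subtype_compl]
  have := K.card_le_univ
  rw [Fintype.card_fin] at this
  unfold homSpan
  omega

lemma finrank_insert_unitSet (K : Finset (Fin d)) :
    Module.finrank ℝ (homSpan (insert 0 (unitSet K))) + K.card = d + 1 := by
  have hli : LinearIndependent ℝ
      (fun o : Option {k // k ∉ K} => hom ((o.map Subtype.val).elim 0 unitVec)) :=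
    linearIndependent_hom_option.comp (fun o : Option {k // k ∉ K} => o.map Subtype.val)
      (Option.map_injective Subtype.val_injective)
  have h := finrank_span_eq_card hli
  have hr : Set.range (fun o : Option {k // k ∉ K} => hom ((o.map Subtype.val).elim 0 unitVec)) =
      hom '' insert 0 (unitSet K) := by
    ext y; simp [unitSet, Option.exists, eq_comm]
  rw [hr] at h
  have hc : Fintype.card {k // k ∉ K} = d - K.card := by
    simp [Fintype.card_subtype_compl]
  rw [Fintype.card_option] at h
  have := K.card_le_univ
  rw [Fintype.card_fin] at this
  unfold homSpan
  omega

/-- The points of `S` whose coordinates with index in `K` vanish. -/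
def coordFace (S : Set (E d)) (K : Finset (Fin d)) : Set (E d) := {x | x ∈ S ∧ ∀ k ∈ K, x k = 0}

lemma hom_mem_insert_unitSet {K : Finset (Fin d)} {x : E d} (hx : ∀ k ∈ K, x k = 0) :
    hom x ∈ homSpan (insert 0 (unitSet K)) := by
  rw [hom_eq]
  refine Submodule.add_mem _ (Submodule.smul_mem _ _ (hom_mem_homSpan (Set.mem_insert _ _)))
    (Submodule.sum_mem _ fun k _ => ?_)
  by_cases hk : k ∈ K
  · rw [hx k hk, zero_smul]; exact Submodule.zero_mem _
  · exact Submodule.smul_mem _ _ (hom_mem_homSpan (Set.mem_insert_of_mem _ ⟨k, hk, rfl⟩))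

lemma hom_mem_unitSet {K : Finset (Fin d)} {x : E d} (hx : ∀ k ∈ K, x k = 0)
    (h1 : height x = 1) : hom x ∈ homSpan (unitSet K) := by
  rw [hom_eq, h1, sub_self, zero_smul, zero_add]
  refine Submodule.sum_mem _ fun k _ => ?_
  by_cases hk : k ∈ K
  · rw [hx k hk, zero_smul]; exact Submodule.zero_mem _
  · exact Submodule.smul_mem _ _ (hom_mem_homSpan ⟨k, hk, rfl⟩)

lemma finrank_add_card_le {S : Set (E d)} {K : Finset (Fin d)}
    (hS : ∀ x ∈ S, ∀ k ∈ K, x k = 0) : Module.finrank ℝ (homSpan S) + K.card ≤ d + 1 := by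
  rw [← finrank_insert_unitSet K]
  exact Nat.add_le_add_right
    (Submodule.finrank_mono (homSpan_le fun x hx => hom_mem_insert_unitSet (hS x hx))) _

lemma finrank_add_card_le_of_height {S : Set (E d)} {K : Finset (Fin d)}
    (hS : ∀ x ∈ S, ∀ k ∈ K, x k = 0) (h1 : ∀ x ∈ S, height x = 1) :
    Module.finrank ℝ (homSpan S) + K.card ≤ d := by
  refine le_trans ?_ (finrank_unitSet K).le
  exact Nat.add_le_add_right
    (Submodule.finrank_mono (homSpan_le fun x hx => hom_mem_unitSet (hS x hx) (h1 x hx))) _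

lemma le_finrank_add_card {S : Set (E d)} {K : Finset (Fin d)}
    (hS : ∀ k ∉ K, unitVec k ∈ S) : d ≤ Module.finrank ℝ (homSpan S) + K.card := by
  conv_lhs => rw [← finrank_unitSet K]
  refine Nat.add_le_add_right (Submodule.finrank_mono (homSpan_mono ?_)) _
  rintro _ ⟨k, hk, rfl⟩
  exact hS k hk

lemma hom_mem_of_finrank {S : Set (E d)} {K : Finset (Fin d)}
    (hS : ∀ x ∈ S, ∀ k ∈ K, x k = 0) (hr : Module.finrank ℝ (homSpan S) + K.card = d + 1)
    {y : E d} (hy : ∀ k ∈ K, y k = 0) : hom y ∈ homSpan S := by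
  have h : homSpan S = homSpan (insert 0 (unitSet K)) := by
    apply Submodule.eq_of_le_of_finrank_eq
    · exact homSpan_le fun x hx => hom_mem_insert_unitSet (hS x hx)
    · have := finrank_insert_unitSet K; omega
  rw [h]
  exact hom_mem_insert_unitSet hy

lemma height_eq_one_of_finrank {S : Set (E d)} {K : Finset (Fin d)}
    (hS : ∀ k ∉ K, unitVec k ∈ S) (hr : Module.finrank ℝ (homSpan S) + K.card = d)
    {x : E d} (hx : x ∈ S) : height x = 1 := by
  have h : homSpan (unitSet K) = homSpan S := by
    apply Submodule.eq_of_le_of_finrank_eq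
    · refine homSpan_mono ?_
      rintro _ ⟨k, hk, rfl⟩
      exact hS k hk
    · have := finrank_unitSet K; omega
  have h0 : depthForm (hom x) = 0 := by
    refine eq_zero_of_mem_homSpan (S := unitSet K) ?_ (h ▸ hom_mem_homSpan hx)
    rintro _ ⟨k, hk, rfl⟩
    simp
  rw [depthForm_hom] at h0
  linarith

lemma sum_coordForm_hom (K : Finset (Fin d)) (x : E d) :
    (∑ k ∈ K, coordForm k) (hom x) = ∑ k ∈ K, x k := by
  simp [LinearMap.sum_apply]

lemma valid_sum_coordForm {S : Set (E d)} (hS : ∀ x ∈ S, ∀ k, 0 ≤ x k) (K : Finset (Fin d)) :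
    Valid S (∑ k ∈ K, coordForm k) := fun x hx => by
  rw [sum_coordForm_hom]
  exact Finset.sum_nonneg fun k _ => hS x hx k

lemma coordFace_eq_zeroSet {S : Set (E d)} (hS : ∀ x ∈ S, ∀ k, 0 ≤ x k) (K : Finset (Fin d)) :
    coordFace S K = zeroSet S (∑ k ∈ K, coordForm k) := by
  ext x
  unfold coordFace zeroSet
  simp only [Set.mem_ofPred_eq, sum_coordForm_hom]
  refine and_congr_right fun hx => ?_
  rw [Finset.sum_eq_zero_iff_of_nonneg fun k _ => hS x hx k]

/-- A form that vanishes at the origin and is nonnegative at the unit vectors cuts out a coordinate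
face of any subset of the orthant. -/
lemma zeroSet_eq_coordFace {S : Set (E d)} (hS : ∀ x ∈ S, ∀ k, 0 ≤ x k) {Λ : Form d}
    (h0 : Λ (hom 0) = 0) (hu : ∀ k, 0 ≤ Λ (hom (unitVec k))) :
    ∃ K : Finset (Fin d), zeroSet S Λ = coordFace S K := by
  refine ⟨Finset.univ.filter fun k => Λ (hom (unitVec k)) ≠ 0, ?_⟩
  ext x
  unfold coordFace zeroSet
  simp only [Set.mem_ofPred_eq]
  refine and_congr_right fun hx => ?_
  rw [form_eq, h0, zero_mul, zero_add,
    Finset.sum_eq_zero_iff_of_nonneg fun k _ => mul_nonneg (hS x hx k) (hu k)]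
  refine forall_congr' fun k => ?_
  simp only [Finset.mem_univ, true_imp_iff, Finset.mem_filter, true_and, mul_eq_zero]
  tauto

/-! ### The glued polytope and its faces -/

/-- A full-dimensional convex subset of the orthant that contains the unit vectors and has facets in
the coordinate hyperplanes. -/
structure IsOrthantBody (S : Set (E d)) : Prop where
  convex : Convex ℝ S
  nonneg : ∀ x ∈ S, ∀ k, 0 ≤ x k
  unitVec_mem : ∀ k, unitVec k ∈ S
  homSpan_eq_top : homSpan S = ⊤
  finrank_coordFace : ∀ k, Module.finrank ℝ (homSpan (coordFace S {k})) = d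

/-- The standard position of `φ(P₁)`: in the standard simplex, with the facet opposite to the origin
in common. -/
structure IsCapped (P : Set (E d)) : Prop extends IsOrthantBody P where
  isPolytope : IsPolytope P
  height_le : ∀ x ∈ P, height x ≤ 1

/-- The standard position of `T(P₂)`: in the orthant, with the origin and the unit vectors
among its vertices. -/
structure IsCorner (R : Set (E d)) : Prop extends IsOrthantBody R where
  isPolytope : IsPolytope R
  zero_mem : (0 : E d) ∈ vertices R
  unitVec_mem_vertices : ∀ k, unitVec k ∈ vertices R

/-- The union of `P` and the part of `R` beyond the hyperplane through the unit vectors. -/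
def glue (P R : Set (E d)) : Set (E d) := P ∪ {x | x ∈ R ∧ 1 ≤ height x}

lemma coordFace_singleton_eq {S : Set (E d)} (hS : ∀ x ∈ S, ∀ k, 0 ≤ x k) (k : Fin d) :
    coordFace S {k} = zeroSet S (coordForm k) := by
  rw [coordFace_eq_zeroSet hS, Finset.sum_singleton]

lemma coordForm_ne_zero (k : Fin d) : (coordForm k : Form d) ≠ 0 := fun h => by
  have := coordForm_hom k (unitVec k)
  rw [h] at this
  simp at this

lemma depthForm_ne_zero : (depthForm : Form d) ≠ 0 := fun h => by
  have := depthForm_hom (0 : E d)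
  rw [h] at this
  simp at this

lemma isCorner_of_nonneg {R : Set (E d)} (hR : IsPolytope R) (hnn : ∀ x ∈ R, ∀ k, 0 ≤ x k)
    (h0 : (0 : E d) ∈ vertices R) (hu : ∀ k, unitVec k ∈ vertices R) : IsCorner R where
  convex := hR.convex
  nonneg := hnn
  unitVec_mem k := vertices_subset R (hu k)
  homSpan_eq_top := hR.homSpan_eq_top
  finrank_coordFace k := by
    apply le_antisymm
    · rw [coordFace_singleton_eq hnn]
      exact finrank_homSpan_zeroSet_le R (coordForm_ne_zero k)
    · have h1 := finrank_insert_unitSet {k}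
      have h2 : homSpan (insert 0 (unitSet {k})) ≤ homSpan (coordFace R {k}) := by
        refine homSpan_mono ?_
        rintro _ (rfl | ⟨m, hm, rfl⟩)
        · exact ⟨vertices_subset R h0, by simp⟩
        · refine ⟨vertices_subset R (hu m), fun j hj => ?_⟩
          have hjk := Finset.mem_singleton.1 hj
          have hmk : ¬ m ∈ ({k} : Finset (Fin d)) := hm
          rw [Finset.mem_singleton] at hmk
          exact unitVec_of_ne (by rw [hjk]; exact Ne.symm hmk)
      have h3 := Submodule.finrank_mono h2
      rw [Finset.card_singleton] at h1
      omega
  isPolytope := hR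
  zero_mem := h0
  unitVec_mem_vertices := hu

/-- Cutting off the vertex at the origin by dropping it from the set of vertices is the same as
cutting along the hyperplane through its neighbors. -/
lemma IsCorner.convexHull_vertices_diff {R : Set (E d)} (hR : IsCorner R) :
    convexHull ℝ (vertices R \ {0}) = {x | x ∈ R ∧ 1 ≤ height x} := by
  have hRP := hR.isPolytope
  have hsub : convexHull ℝ (vertices R \ {0}) ⊆ R :=
    convexHull_min (Set.sdiff_subset.trans (vertices_subset R)) hR.convex
  have hu : ∀ k, unitVec k ∈ vertices R \ {0} := fun k => ⟨hR.unitVec_mem_vertices k, fun h => by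
    have : unitVec k = 0 := h
    have h1 := unitVec_self k
    rw [this] at h1
    simp at h1⟩
  -- a vertex below the hyperplane lies in the standard simplex
  have hheight : ∀ x ∈ vertices R \ {0}, 1 ≤ height x := by
    rintro x ⟨hx, hx0⟩
    by_contra! hcon
    have h1 : x ∈ convexHull ℝ (insert 0 (Set.range unitVec)) :=
      mem_of_height_le_one (convex_convexHull ℝ _) (subset_convexHull ℝ _ (Set.mem_insert _ _))
        (fun k => subset_convexHull ℝ _ (Set.mem_insert_of_mem _ (Set.mem_range_self k)))
        (hR.nonneg x (vertices_subset R hx)) hcon.le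
    have h2 : convexHull ℝ (insert 0 (Set.range unitVec)) ⊆ R := by
      refine convexHull_min ?_ hR.convex
      rintro _ (rfl | ⟨k, rfl⟩)
      · exact vertices_subset R hR.zero_mem
      · exact hR.unitVec_mem k
    rcases mem_of_mem_vertices hx h2 h1 with h | ⟨k, rfl⟩
    · exact hx0 h
    · simp at hcon
  apply Set.Subset.antisymm
  · intro x hx
    refine ⟨hsub hx, ?_⟩
    have hv : Valid (vertices R \ {0}) (-depthForm) := fun y hy => by
      have := hheight y hy
      simp only [LinearMap.neg_apply, depthForm_hom]
      linarith
    have := valid_convexHull hv x hx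
    simp only [LinearMap.neg_apply, depthForm_hom] at this
    linarith
  · rintro x ⟨hx, hx1⟩
    have hne : (vertices R \ {0}).Nonempty := by
      by_contra hcon
      rw [Set.not_nonempty_iff_eq_empty] at hcon
      have hd : ∀ k : Fin d, False := fun k => by
        have := hu k
        rw [hcon] at this
        exact this
      have : height x = 0 := Finset.sum_eq_zero fun k _ => (hd k).elim
      linarith
    have hxv : x ∈ convexHull ℝ (insert 0 (vertices R \ {0})) := by
      rw [Set.insert_sdiff_singleton, Set.insert_eq_of_mem hR.zero_mem, hRP.convexHull_vertices]
      exact hx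
    rw [convexHull_insert hne, mem_convexJoin] at hxv
    obtain ⟨_, rfl, c, hc, hxc⟩ := hxv
    -- `x` lies between `c` and the point of the ray through `c` at height one
    rw [segment_eq_image'] at hxc
    obtain ⟨t, ⟨ht0, ht1⟩, rfl⟩ := hxc
    simp only [sub_zero, zero_add] at hx hx1 ⊢
    have hht : ∀ r : ℝ, height (r • c) = r * height c := fun r => by
      simp [height, Finset.mul_sum]
    rw [hht] at hx1
    have hcpos : 0 < height c := by
      rcases lt_or_ge 0 (height c) with h | h
      · exact h
      · have := mul_nonneg ht0 (neg_nonneg.2 h)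
        linarith
    have htpos : (height c)⁻¹ ≤ t := by
      rw [inv_le_iff_one_le_mul₀ hcpos]
      exact hx1
    have hlow : (height c)⁻¹ • c ∈ convexHull ℝ (vertices R \ {0}) := by
      apply mem_of_height_eq_one (convex_convexHull ℝ _) (fun k => subset_convexHull ℝ _ (hu k))
      · intro k
        have := hR.nonneg c (hsub hc) k
        simp only [PiLp.smul_apply, smul_eq_mul]
        positivity
      · rw [hht, inv_mul_cancel₀ hcpos.ne']
    have hconv : Convex ℝ {r : ℝ | r • c ∈ convexHull ℝ (vertices R \ {0})} := by
      intro p hp q hq α β hα hβ hαβ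
      change (α • p + β • q) • c ∈ convexHull ℝ (vertices R \ {0})
      rw [add_smul, smul_assoc, smul_assoc]
      exact convex_convexHull ℝ _ hp hq hα hβ hαβ
    exact hconv.ordConnected.out hlow (by simpa using hc) ⟨htpos, ht1⟩

section Glue

variable {P R : Set (E d)}

lemma glue_nonneg (hP : IsCapped P) (hR : IsCorner R) : ∀ x ∈ glue P R, ∀ k, 0 ≤ x k := by
  rintro x (hx | ⟨hx, -⟩)
  · exact hP.nonneg x hx
  · exact hR.nonneg x hx

lemma height_combo (x y : E d) (p q : ℝ) :
    height (p • x + q • y) = p * height x + q * height y := by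
  simp [height, Finset.sum_add_distrib, Finset.mul_sum]

/-- The union is convex: a segment from one part to the other crosses the hyperplane through the
unit vectors inside the orthant, hence in the common simplex facet. -/
lemma convex_glue (hP : IsCapped P) (hR : IsCorner R) : Convex ℝ (glue P R) := by
  have hC : Convex ℝ {x | x ∈ R ∧ 1 ≤ height x} := by
    rw [← hR.convexHull_vertices_diff]; exact convex_convexHull ℝ _
  have key : ∀ x ∈ P, ∀ y, y ∈ R ∧ 1 ≤ height y → segment ℝ x y ⊆ glue P R := by
    rintro x hx y ⟨hy, hy1⟩
    have hx1 := hP.height_le x hx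
    have hgx : ∀ k, 0 ≤ x k := hP.nonneg x hx
    have hgy : ∀ k, 0 ≤ y k := hR.nonneg y hy
    obtain ⟨z, hzseg, hz1⟩ : ∃ z ∈ segment ℝ x y, height z = 1 := by
      rcases hx1.eq_or_lt with h | h
      · exact ⟨x, left_mem_segment ℝ x y, h⟩
      · have hpos : 0 < height y - height x := by linarith
        refine ⟨((height y - 1) / (height y - height x)) • x +
          ((1 - height x) / (height y - height x)) • y,
          ⟨_, _, div_nonneg (by linarith) hpos.le, div_nonneg (by linarith) hpos.le,
            by field_simp; ring, rfl⟩, ?_⟩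
        rw [height_combo]
        field_simp
        ring
    have hz0 : ∀ k, 0 ≤ z k := by
      obtain ⟨p, q, hp, hq, -, rfl⟩ := hzseg
      intro k
      have h1 := mul_nonneg hp (hgx k)
      have h2 := mul_nonneg hq (hgy k)
      simpa using add_nonneg h1 h2
    have hzP : z ∈ P := mem_of_height_eq_one hP.convex hP.unitVec_mem hz0 hz1
    have hzR : z ∈ R := mem_of_height_eq_one hR.convex hR.unitVec_mem hz0 hz1
    have hsplit : segment ℝ x y ⊆ segment ℝ x z ∪ segment ℝ z y := by
      rw [← insert_endpoints_openSegment]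
      refine Set.insert_subset (Or.inl (left_mem_segment ℝ x z))
        (Set.insert_subset (Or.inr (right_mem_segment ℝ z y)) ?_)
      have hline : z ∈ Set.range (AffineMap.lineMap x y : ℝ → E d) := by
        rw [segment_eq_image_lineMap] at hzseg
        exact Set.image_subset_range _ _ hzseg
      refine (openSegment_subset_union x y hline).trans
        (Set.insert_subset (Or.inl (right_mem_segment ℝ x z)) ?_)
      exact Set.union_subset_union (openSegment_subset_segment ℝ x z)
        (openSegment_subset_segment ℝ z y)
    refine hsplit.trans (Set.union_subset ?_ ?_)
    · exact (hP.convex.segment_subset hx hzP).trans Set.subset_union_left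
    · exact (hC.segment_subset ⟨hzR, hz1.ge⟩ ⟨hy, hy1⟩).trans Set.subset_union_right
  rw [convex_iff_segment_subset]
  rintro x (hx | hx) y (hy | hy)
  · exact (hP.convex.segment_subset hx hy).trans Set.subset_union_left
  · exact key x hx y hy
  · rw [segment_symm]; exact key y hy x hx
  · exact (hC.segment_subset hx hy).trans Set.subset_union_right

lemma isPolytope_glue (hP : IsCapped P) (hR : IsCorner R) : IsPolytope (glue P R) := by
  have hPp := hP.isPolytope
  have hRp := hR.isPolytope
  have hne : (glue P R).Nonempty := hPp.2.1.mono Set.subset_union_left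
  refine ⟨⟨vertices P ∪ vertices R \ {0},
    hPp.vertices_finite.union (hRp.vertices_finite.subset Set.sdiff_subset), ?_⟩, hne, ?_⟩
  · apply Set.Subset.antisymm
    · refine Set.union_subset ?_ ?_
      · conv_lhs => rw [← hPp.convexHull_vertices]
        exact convexHull_mono Set.subset_union_left
      · rw [← hR.convexHull_vertices_diff]
        exact convexHull_mono Set.subset_union_right
    · refine convexHull_min (Set.union_subset ?_ ?_) (convex_glue hP hR)
      · exact (vertices_subset P).trans Set.subset_union_left
      · refine Set.Subset.trans ?_ (Set.subset_union_right (s := P))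
        rw [← hR.convexHull_vertices_diff]
        exact subset_convexHull ℝ _
  · rw [← homSpan_eq_top_iff hne, eq_top_iff, ← hP.homSpan_eq_top]
    exact homSpan_mono Set.subset_union_left

lemma isOrthantBody_glue (hP : IsCapped P) (hR : IsCorner R) : IsOrthantBody (glue P R) where
  convex := convex_glue hP hR
  nonneg := glue_nonneg hP hR
  unitVec_mem k := Or.inl (hP.unitVec_mem k)
  homSpan_eq_top := (isPolytope_glue hP hR).homSpan_eq_top
  finrank_coordFace k := by
    apply le_antisymm
    · rw [coordFace_singleton_eq (glue_nonneg hP hR)]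
      exact finrank_homSpan_zeroSet_le _ (coordForm_ne_zero k)
    · conv_lhs => rw [← hP.finrank_coordFace k]
      exact Submodule.finrank_mono (homSpan_mono fun x hx => ⟨Or.inl hx.1, hx.2⟩)

lemma mem_glue_height_eq_one (hP : IsCapped P) (hR : IsCorner R) {x : E d} (hx : ∀ k, 0 ≤ x k)
    (h1 : height x = 1) : x ∈ P ∧ x ∈ R :=
  ⟨mem_of_height_eq_one hP.convex hP.unitVec_mem hx h1,
    mem_of_height_eq_one hR.convex hR.unitVec_mem hx h1⟩

lemma Valid.unitVec_nonneg {S : Set (E d)} (hS : IsOrthantBody S) {Λ : Form d} (hv : Valid S Λ)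
    (k : Fin d) : 0 ≤ Λ (hom (unitVec k)) := hv _ (hS.unitVec_mem k)

lemma sum_mul_nonneg {S : Set (E d)} (hS : IsOrthantBody S) {Λ : Form d} (hv : Valid S Λ)
    {x : E d} (hx : ∀ k, 0 ≤ x k) : 0 ≤ ∑ k, x k * Λ (hom (unitVec k)) :=
  Finset.sum_nonneg fun k _ => mul_nonneg (hx k) (hv.unitVec_nonneg hS k)

/-- An affine function that is nonnegative on `R` and positive at the origin is nonnegative on the
union, and all its zeros lie in `R`. -/
lemma valid_glue_of_pos (hP : IsCapped P) (hR : IsCorner R) {Λ : Form d}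
    (h0 : 0 < Λ (hom 0)) (hv : Valid R Λ) : Valid (glue P R) Λ := by
  rintro x (hx | hx)
  · rw [form_eq]
    have h1 := sum_mul_nonneg hR.toIsOrthantBody hv (hP.nonneg x hx)
    have h2 := mul_nonneg h0.le (sub_nonneg.2 (hP.height_le x hx))
    linarith
  · exact hv x hx.1

lemma valid_of_valid_glue_of_pos (hP : IsCapped P) (hR : IsCorner R) {Λ : Form d}
    (h0 : 0 < Λ (hom 0)) (hv : Valid (glue P R) Λ) : Valid R Λ := by
  intro x hx
  rcases le_total 1 (height x) with h | h
  · exact hv x (Or.inr ⟨hx, h⟩)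
  · rw [form_eq]
    have h1 := sum_mul_nonneg (isOrthantBody_glue hP hR) hv (hR.nonneg x hx)
    have h2 := mul_nonneg h0.le (sub_nonneg.2 h)
    linarith

lemma height_eq_one_of_zero {S : Set (E d)} (hS : IsOrthantBody S) {Λ : Form d}
    (hv : Valid S Λ) {x : E d} (hx : ∀ k, 0 ≤ x k) (hx0 : Λ (hom x) = 0)
    (h : 0 < Λ (hom 0) ∧ height x ≤ 1 ∨ Λ (hom 0) < 0 ∧ 1 ≤ height x) : height x = 1 := by
  rw [form_eq] at hx0
  have h1 := sum_mul_nonneg hS hv hx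
  rcases h with ⟨h0, h⟩ | ⟨h0, h⟩
  · nlinarith
  · nlinarith

lemma zeroSet_glue_of_pos (hP : IsCapped P) (hR : IsCorner R) {Λ : Form d}
    (h0 : 0 < Λ (hom 0)) (hv : Valid (glue P R) Λ) : zeroSet (glue P R) Λ = zeroSet R Λ := by
  have hQ := isOrthantBody_glue hP hR
  ext x
  constructor
  · rintro ⟨hx | hx, hx0⟩
    · have h1 := height_eq_one_of_zero hQ hv (hP.nonneg x hx) hx0
        (Or.inl ⟨h0, hP.height_le x hx⟩)
      exact ⟨(mem_glue_height_eq_one hP hR (hP.nonneg x hx) h1).2, hx0⟩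
    · exact ⟨hx.1, hx0⟩
  · rintro ⟨hx, hx0⟩
    refine ⟨?_, hx0⟩
    rcases le_total 1 (height x) with h | h
    · exact Or.inr ⟨hx, h⟩
    · have h1 := height_eq_one_of_zero hQ hv (hR.nonneg x hx) hx0 (Or.inl ⟨h0, h⟩)
      exact Or.inr ⟨hx, h1.ge⟩

lemma valid_glue_of_neg (hP : IsCapped P) (hR : IsCorner R) {Λ : Form d}
    (h0 : Λ (hom 0) < 0) (hv : Valid P Λ) : Valid (glue P R) Λ := by
  rintro x (hx | hx)
  · exact hv x hx
  · rw [form_eq]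
    have h1 := sum_mul_nonneg hP.toIsOrthantBody hv (hR.nonneg x hx.1)
    have h2 := mul_nonneg_of_nonpos_of_nonpos h0.le (sub_nonpos.2 hx.2)
    linarith

lemma valid_of_valid_glue {Λ : Form d} (hv : Valid (glue P R) Λ) : Valid P Λ :=
  fun x hx => hv x (Or.inl hx)

lemma zeroSet_glue_of_neg (hP : IsCapped P) (hR : IsCorner R) {Λ : Form d}
    (h0 : Λ (hom 0) < 0) (hv : Valid (glue P R) Λ) : zeroSet (glue P R) Λ = zeroSet P Λ := by
  have hQ := isOrthantBody_glue hP hR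
  ext x
  constructor
  · rintro ⟨hx | hx, hx0⟩
    · exact ⟨hx, hx0⟩
    · have h1 := height_eq_one_of_zero hQ hv (hR.nonneg x hx.1) hx0 (Or.inr ⟨h0, hx.2⟩)
      exact ⟨(mem_glue_height_eq_one hP hR (hR.nonneg x hx.1) h1).1, hx0⟩
  · rintro ⟨hx, hx0⟩
    exact ⟨Or.inl hx, hx0⟩

lemma zeroSet_eq_coordFace_of_valid {S : Set (E d)} (hS : IsOrthantBody S) {Λ : Form d}
    (h0 : Λ (hom 0) = 0) (hv : Valid S Λ) : ∃ K, zeroSet S Λ = coordFace S K :=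
  zeroSet_eq_coordFace hS.nonneg h0 fun k => hv.unitVec_nonneg hS k

lemma IsOrthantBody.unitVec_mem_coordFace {S : Set (E d)} (hS : IsOrthantBody S)
    {K : Finset (Fin d)} {k : Fin d} (hk : k ∉ K) : unitVec k ∈ coordFace S K :=
  ⟨hS.unitVec_mem k, fun _ hm => unitVec_of_ne fun h => hk (h ▸ hm)⟩

lemma isFace_of_finrank {S G : Set (E d)} {k : ℕ} {Λ : Form d} (hv : Valid S Λ)
    (hG : G = zeroSet S Λ) (hne : G.Nonempty) (hr : Module.finrank ℝ (homSpan G) = k + 1) :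
    IsFace S k G := isFace_iff.2 ⟨hne, ⟨Λ, hv, hG⟩, hr⟩

/-! ### Simplicial merges -/

/-- Every `j`-face of the union is a `j`-face of `P` or of `R`. For a coordinate face this holds
because it lies in `P`: either it is contained in the common simplex facet, or the corresponding
coordinate face of `R` is a `j`-simplex, and the origin and the `j` unit vectors in it are all its
vertices. -/
lemma isSimplicial_glue (hP : IsCapped P) (hR : IsCorner R) {j : ℕ}
    (hPj : IsSimplicial j P) (hRj : IsSimplicial j R) : IsSimplicial j (glue P R) := by
  intro G hG
  obtain ⟨hne, ⟨Λ, hv, rfl⟩, hr⟩ := isFace_iff.1 hG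
  have hQ := isOrthantBody_glue hP hR
  rcases lt_trichotomy (Λ (hom 0)) 0 with h0 | h0 | h0
  · exact hPj _ (isFace_of_finrank (valid_of_valid_glue hv)
      (zeroSet_glue_of_neg hP hR h0 hv) hne hr)
  · obtain ⟨K, hK⟩ := zeroSet_eq_coordFace_of_valid hQ h0 hv
    rw [hK] at hne hr ⊢
    have h1 := finrank_add_card_le (S := coordFace (glue P R) K) (K := K) fun x hx => hx.2
    have h2 := le_finrank_add_card (S := coordFace (glue P R) K) (K := K)
      fun k hk => hQ.unitVec_mem_coordFace hk
    have hle : ∀ x ∈ coordFace (glue P R) K, x ∈ P := by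
      rcases (by omega : j + 1 + K.card = d ∨ j + K.card = d) with h | h
      · intro x hx
        have := height_eq_one_of_finrank (S := coordFace (glue P R) K) (K := K)
          (fun k hk => hQ.unitVec_mem_coordFace hk) (by omega) hx
        exact (mem_glue_height_eq_one hP hR (hQ.nonneg x hx.1) this).1
      · have hspan : homSpan (insert 0 (unitSet K)) ≤ homSpan (coordFace R K) := by
          refine homSpan_mono ?_
          rintro _ (rfl | ⟨k, hk, rfl⟩)
          · exact ⟨vertices_subset R hR.zero_mem, by simp⟩
          · exact hR.unitVec_mem_coordFace hk
        have h3 := Submodule.finrank_mono hspan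
        have h4 := finrank_insert_unitSet K
        have h5 := finrank_add_card_le (S := coordFace R K) (K := K) fun x hx => hx.2
        obtain ⟨p, hp, hpR⟩ := hRj _ (isFace_of_finrank (k := j)
          (valid_sum_coordForm hR.nonneg K) (coordFace_eq_zeroSet hR.nonneg K)
          ⟨0, vertices_subset R hR.zero_mem, by simp⟩ (by omega))
        have hpsub : convexHull ℝ (Set.range p) ⊆ R := hpR ▸ fun x hx => hx.1
        have hsub : insert 0 (unitSet K) ⊆ Set.range p := by
          rintro _ (rfl | ⟨k, hk, rfl⟩)
          · refine mem_of_mem_vertices hR.zero_mem hpsub ?_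
            rw [← hpR]
            exact ⟨vertices_subset R hR.zero_mem, by simp⟩
          · refine mem_of_mem_vertices (hR.unitVec_mem_vertices k) hpsub ?_
            rw [← hpR]
            exact hR.unitVec_mem_coordFace hk
        -- both sets have `j + 1` elements
        have hcard : Set.range p = insert 0 (unitSet K) := by
          refine (Set.eq_of_subset_of_ncard_le hsub ?_ (Set.finite_range p)).symm
          have e1 : (Set.range p).ncard ≤ j + 1 := by
            rw [← Set.image_univ]
            refine (Set.ncard_image_le Set.finite_univ).trans ?_
            simp
          have e2 : Module.finrank ℝ (homSpan (insert 0 (unitSet K))) ≤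
              (insert 0 (unitSet K)).ncard := by
            have hfin : (insert 0 (unitSet K)).Finite := (Set.finite_range p).subset hsub
            have : Fintype (hom '' insert 0 (unitSet K)) := (hfin.image hom).fintype
            refine (finrank_span_le_card (R := ℝ) (hom '' insert 0 (unitSet K))).trans ?_
            rw [← Set.ncard_eq_toFinset_card', Set.ncard_image_of_injective _ hom_injective]
          omega
        have hRle : ∀ x ∈ coordFace R K, height x ≤ 1 := by
          intro x hx
          rw [hpR, hcard] at hx
          have hv : Valid (insert 0 (unitSet K)) depthForm := by
            rintro _ (rfl | ⟨k, -, rfl⟩)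
            · simp
            · simp
          have := valid_convexHull hv x hx
          rw [depthForm_hom] at this
          linarith
        rintro x ⟨hx | ⟨hx, hx1⟩, hxK⟩
        · exact hx
        · exact (mem_glue_height_eq_one hP hR (hR.nonneg x hx)
            (le_antisymm (hRle x ⟨hx, hxK⟩) hx1)).1
    have heq : coordFace (glue P R) K = coordFace P K :=
      Set.Subset.antisymm (fun x hx => ⟨hle x hx, hx.2⟩) fun x hx => ⟨Or.inl hx.1, hx.2⟩
    rw [heq] at hne hr ⊢
    exact hPj _ (isFace_of_finrank (valid_sum_coordForm hP.nonneg K)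
      (coordFace_eq_zeroSet hP.nonneg K) hne hr)
  · exact hRj _ (isFace_of_finrank (valid_of_valid_glue_of_pos hP hR h0 hv)
      (zeroSet_glue_of_pos hP hR h0 hv) hne hr)

end Glue

/-! ### Simple merges -/

/-- The facets of `S` through `G` whose affine function has a value at the origin that satisfies
`p`. -/
def facetsOn (S G : Set (E d)) (p : ℝ → Prop) : Set (Set (E d)) :=
  {H | G ⊆ H ∧ Module.finrank ℝ (homSpan H) = d ∧
    ∃ Λ : Form d, Valid S Λ ∧ p (Λ (hom 0)) ∧ H = zeroSet S Λ}

lemma facets_eq {S G : Set (E d)} (hG : G.Nonempty) :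
    {H | IsFacet S H ∧ G ⊆ H} =
      facetsOn S G (0 < ·) ∪ facetsOn S G (· < 0) ∪ facetsOn S G (· = 0) := by
  ext H
  constructor
  · rintro ⟨hH, hGH⟩
    obtain ⟨-, ⟨Λ, hv, hz⟩, hr⟩ := isFacet_iff.1 hH
    rcases lt_trichotomy (Λ (hom 0)) 0 with h | h | h
    · exact Or.inl (Or.inr ⟨hGH, hr, Λ, hv, h, hz⟩)
    · exact Or.inr ⟨hGH, hr, Λ, hv, h, hz⟩
    · exact Or.inl (Or.inl ⟨hGH, hr, Λ, hv, h, hz⟩)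
  · rintro ((⟨hGH, hr, Λ, hv, -, hz⟩ | ⟨hGH, hr, Λ, hv, -, hz⟩) | ⟨hGH, hr, Λ, hv, -, hz⟩) <;>
      exact ⟨isFacet_iff.2 ⟨hG.mono hGH, ⟨Λ, hv, hz⟩, hr⟩, hGH⟩

/-- The indices of the coordinates that vanish on `G`. -/
def zeroCoords (G : Set (E d)) : Set (Fin d) := {k | ∀ x ∈ G, x k = 0}

lemma facetsOn_zero {S G : Set (E d)} (hS : IsOrthantBody S) (hGS : G ⊆ S) :
    facetsOn S G (· = 0) = (fun k => coordFace S {k}) '' zeroCoords G := by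
  ext H
  constructor
  · rintro ⟨hGH, hr, Λ, hv, h0, hz⟩
    obtain ⟨K, hK⟩ := zeroSet_eq_coordFace_of_valid hS h0 hv
    rw [hK] at hz
    subst hz
    have h1 := finrank_add_card_le (S := coordFace S K) (K := K) fun x hx => hx.2
    have h2 : K.card ≠ 0 := by
      intro h
      rw [Finset.card_eq_zero] at h
      have : coordFace S K = S := by ext x; simp [coordFace, h]
      rw [this, hS.homSpan_eq_top, finrank_top, finrank_hom] at hr
      omega
    obtain ⟨k, rfl⟩ := Finset.card_eq_one.1 (by omega : K.card = 1)
    exact ⟨k, fun x hx => (hGH hx).2 k (Finset.mem_singleton_self k), rfl⟩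
  · rintro ⟨k, hk, rfl⟩
    refine ⟨fun x hx => ⟨hGS hx, fun m hm => ?_⟩, hS.finrank_coordFace k, coordForm k,
      fun x hx => hS.nonneg x hx k, by simp, coordFace_singleton_eq hS.nonneg k⟩
    rw [Finset.mem_singleton.1 hm]
    exact hk x hx

lemma injective_coordFace {S : Set (E d)} (hS : IsOrthantBody S) :
    Function.Injective fun k => coordFace S {k} := by
  intro k m h
  by_contra hkm
  have h1 : unitVec m ∈ coordFace S {k} :=
    hS.unitVec_mem_coordFace (by simpa using fun h => hkm h.symm)
  change coordFace S {k} = coordFace S {m} at h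
  rw [h] at h1
  have := h1.2 m (Finset.mem_singleton_self m)
  simp at this

/-- The span of a coordinate facet contains the origin, so no facet of another kind is equal to a
coordinate facet, and the two kinds can be counted separately. -/
lemma ncard_union_facetsOn_zero {S G : Set (E d)} (hS : IsOrthantBody S) (hGS : G ⊆ S)
    {X : Set (Set (E d))} (hX : X.Finite)
    (hne : ∀ H ∈ X, ∃ Λ : Form d, Λ (hom 0) ≠ 0 ∧ ∀ x ∈ H, Λ (hom x) = 0) :
    (X ∪ facetsOn S G (· = 0)).ncard = X.ncard + (zeroCoords G).ncard := by
  rw [facetsOn_zero hS hGS, Set.ncard_union_eq ?_ hX ((Set.toFinite _).image _),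
    Set.ncard_image_of_injective _ (injective_coordFace hS)]
  rw [Set.disjoint_left]
  rintro _ hH ⟨k, -, rfl⟩
  obtain ⟨Λ, h0, hz⟩ := hne _ hH
  refine h0 (eq_zero_of_mem_homSpan hz ?_)
  refine hom_mem_of_finrank (K := {k}) (fun x hx => hx.2) ?_ (by simp)
  change Module.finrank ℝ (homSpan (coordFace S {k})) + _ = _
  rw [hS.finrank_coordFace k, Finset.card_singleton]

lemma exists_form_of_mem_facetsOn {S G H : Set (E d)} {p : ℝ → Prop} (hp : ¬ p 0)
    (h : H ∈ facetsOn S G p) : ∃ Λ : Form d, Λ (hom 0) ≠ 0 ∧ ∀ x ∈ H, Λ (hom x) = 0 := by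
  obtain ⟨-, -, Λ, -, h0, rfl⟩ := h
  exact ⟨Λ, fun h => hp (h ▸ h0), fun x hx => hx.2⟩

section Glue

variable {P R G : Set (E d)}

lemma facetsOn_glue_pos (hP : IsCapped P) (hR : IsCorner R) :
    facetsOn (glue P R) G (0 < ·) = facetsOn R G (0 < ·) := by
  ext H
  constructor
  · rintro ⟨hGH, hr, Λ, hv, h0, hz⟩
    exact ⟨hGH, hr, Λ, valid_of_valid_glue_of_pos hP hR h0 hv, h0,
      by rw [hz, zeroSet_glue_of_pos hP hR h0 hv]⟩
  · rintro ⟨hGH, hr, Λ, hv, h0, hz⟩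
    have hv' := valid_glue_of_pos hP hR h0 hv
    exact ⟨hGH, hr, Λ, hv', h0, by rw [hz, zeroSet_glue_of_pos hP hR h0 hv']⟩

lemma facetsOn_glue_neg (hP : IsCapped P) (hR : IsCorner R) :
    facetsOn (glue P R) G (· < 0) = facetsOn P G (· < 0) := by
  ext H
  constructor
  · rintro ⟨hGH, hr, Λ, hv, h0, hz⟩
    exact ⟨hGH, hr, Λ, valid_of_valid_glue hv, h0, by rw [hz, zeroSet_glue_of_neg hP hR h0 hv]⟩
  · rintro ⟨hGH, hr, Λ, hv, h0, hz⟩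
    have hv' := valid_glue_of_neg hP hR h0 hv
    exact ⟨hGH, hr, Λ, hv', h0, by rw [hz, zeroSet_glue_of_neg hP hR h0 hv']⟩

lemma facetsOn_corner_neg (hR : IsCorner R) : facetsOn R G (· < 0) = ∅ := by
  rw [Set.eq_empty_iff_forall_notMem]
  rintro H ⟨-, -, Λ, hv, h0, -⟩
  exact absurd (hv 0 (vertices_subset R hR.zero_mem)) (not_le.2 h0)

/-- A facet whose affine function is positive at the origin does not meet the region below the
hyperplane through the unit vectors. -/
lemma facetsOn_pos_eq_empty {S : Set (E d)} (hS : IsOrthantBody S)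
    (hG : ∃ x ∈ G, (∀ k, 0 ≤ x k) ∧ height x < 1) : facetsOn S G (0 < ·) = ∅ := by
  rw [Set.eq_empty_iff_forall_notMem]
  rintro H ⟨hGH, -, Λ, hv, h0, rfl⟩
  obtain ⟨x, hx, hx0, hx1⟩ := hG
  exact hx1.ne (height_eq_one_of_zero hS hv hx0 (hGH hx).2 (Or.inl ⟨h0, hx1.le⟩))

lemma IsCapped.exists_height_lt (hP : IsCapped P) : ∃ x ∈ P, height x < 1 := by
  by_contra! hcon
  exact depthForm_ne_zero (form_eq_zero hP.homSpan_eq_top fun x hx => by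
    rw [depthForm_hom]
    linarith [hP.height_le x hx, hcon x hx])

lemma valid_depthForm (hP : IsCapped P) : Valid P depthForm := fun x hx => by
  rw [depthForm_hom]
  linarith [hP.height_le x hx]

/-- If `P` is `i`-simple, then the only facets through a `(d - i - 1)`-face of the simplex facet are
the simplex facet itself and `i` coordinate facets. -/
lemma facetsOn_neg_eq_empty (hP : IsCapped P) {i : ℕ} (hid : i + 1 ≤ d)
    (hPi : IsSimple i P) (hne : G.Nonempty)
    (hr : Module.finrank ℝ (homSpan G) = d - i) (h1 : ∀ x ∈ G, height x = 1)
    {K : Finset (Fin d)} (hGK : G = {x | x ∈ P ∧ height x = 1 ∧ ∀ k ∈ K, x k = 0}) :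
    facetsOn P G (· < 0) = ∅ := by
  have hGP : G ⊆ P := by rw [hGK]; exact fun x hx => hx.1
  have hGK' : ∀ x ∈ G, ∀ k ∈ K, x k = 0 := by rw [hGK]; exact fun x hx => hx.2.2
  have hu : ∀ k ∉ K, unitVec k ∈ G := fun k hk => by
    rw [hGK]
    exact ⟨hP.unitVec_mem k, height_unitVec k, (hP.unitVec_mem_coordFace hk).2⟩
  have hcard : K.card = i := by
    have e1 := finrank_add_card_le_of_height hGK' h1
    have e2 := le_finrank_add_card hu
    omega
  rw [Set.eq_empty_iff_forall_notMem]
  intro H hH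
  have hface : IsFace P (d - i - 1) G := by
    have hev : ∀ x, (depthForm + ∑ k ∈ K, coordForm k : Form d) (hom x) =
        (1 - height x) + ∑ k ∈ K, x k := fun x => by
      rw [LinearMap.add_apply, depthForm_hom, sum_coordForm_hom]
    refine isFace_of_finrank (Λ := depthForm + ∑ k ∈ K, coordForm k) ?_ ?_ hne (by omega)
    · exact fun x hx => add_nonneg (valid_depthForm hP x hx) (valid_sum_coordForm hP.nonneg K x hx)
    · rw [hGK]
      ext x
      unfold zeroSet
      simp only [Set.mem_ofPred_eq, hev]
      refine and_congr_right fun hx => ?_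
      have e1 := hP.height_le x hx
      have e2 := Finset.sum_nonneg fun k (_ : k ∈ K) => hP.nonneg x hx k
      rw [← Finset.sum_eq_zero_iff_of_nonneg fun k _ => hP.nonneg x hx k]
      constructor
      · rintro ⟨e3, e4⟩; linarith
      · intro e3; exact ⟨by linarith, by linarith⟩
  have hF : zeroSet P depthForm ∈ facetsOn P G (0 < ·) := by
    refine ⟨fun x hx => ⟨hGP hx, by rw [depthForm_hom, h1 x hx, sub_self]⟩, ?_, depthForm,
      valid_depthForm hP, by simp, rfl⟩
    apply le_antisymm (finrank_homSpan_zeroSet_le P depthForm_ne_zero)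
    have := le_finrank_add_card (S := zeroSet P depthForm) (K := ∅)
      fun k _ => ⟨hP.unitVec_mem k, by simp⟩
    simpa using this
  have hHF : zeroSet P depthForm ≠ H := by
    rintro rfl
    obtain ⟨-, -, M, hM, hM0, hz⟩ := hH
    have hMu : ∀ k, M (hom (unitVec k)) = 0 := fun k => by
      have : unitVec k ∈ zeroSet P M := hz ▸ ⟨hP.unitVec_mem k, by simp⟩
      exact this.2
    obtain ⟨x, hx, hx1⟩ := hP.exists_height_lt
    have h2 := hM x hx
    have h3 := mul_neg_of_neg_of_pos hM0 (sub_pos.2 hx1)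
    rw [form_eq] at h2
    simp only [hMu, mul_zero, Finset.sum_const_zero, add_zero] at h2
    linarith
  have hfin : ({zeroSet P depthForm, H} : Set (Set (E d))).Finite := Set.toFinite _
  have hcount := ncard_union_facetsOn_zero hP.toIsOrthantBody hGP hfin (by
    rintro _ (rfl | rfl)
    · exact exists_form_of_mem_facetsOn (lt_irrefl 0) hF
    · exact exists_form_of_mem_facetsOn (p := (· < 0)) (lt_irrefl 0) hH)
  have hall := hPi G hface
  rw [facets_eq hne] at hall
  have hle := Set.ncard_le_ncard (s := {zeroSet P depthForm, H} ∪ facetsOn P G (· = 0))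
    (t := facetsOn P G (0 < ·) ∪ facetsOn P G (· < 0) ∪ facetsOn P G (· = 0)) (by
      refine Set.union_subset_union_left _ ?_
      rintro _ (rfl | rfl)
      · exact Or.inl hF
      · exact Or.inr hH) (Set.finite_of_ncard_ne_zero (by omega))
  rw [hcount, hall, Set.ncard_pair hHF] at hle
  have hK : K.card ≤ (zeroCoords G).ncard := by
    rw [← Set.ncard_coe_finset]
    exact Set.ncard_le_ncard (fun k hk x hx => hGK' x hx k hk) (Set.toFinite _)
  omega

/-- A face in the hyperplane through the unit vectors is cut out by vanishing coordinates. -/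
lemma zeroSet_eq_of_height {S : Set (E d)} (hS : IsOrthantBody S) {Λ : Form d} (hv : Valid S Λ)
    (h1 : ∀ x ∈ zeroSet S Λ, height x = 1) :
    ∃ K : Finset (Fin d), zeroSet S Λ = {x | x ∈ S ∧ height x = 1 ∧ ∀ k ∈ K, x k = 0} := by
  refine ⟨Finset.univ.filter fun k => Λ (hom (unitVec k)) ≠ 0, ?_⟩
  have key : ∀ x ∈ S, height x = 1 → (Λ (hom x) = 0 ↔
      ∀ k ∈ Finset.univ.filter fun k => Λ (hom (unitVec k)) ≠ 0, x k = 0) := by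
    intro x hx hx1
    rw [form_eq, hx1, sub_self, mul_zero, zero_add, Finset.sum_eq_zero_iff_of_nonneg
      fun k _ => mul_nonneg (hS.nonneg x hx k) (hv.unitVec_nonneg hS k)]
    refine forall_congr' fun k => ?_
    simp only [Finset.mem_univ, true_imp_iff, Finset.mem_filter, true_and, mul_eq_zero]
    tauto
  ext x
  constructor
  · intro hx
    exact ⟨hx.1, h1 x hx, (key x hx.1 (h1 x hx)).1 hx.2⟩
  · rintro ⟨hx, hx1, hK⟩
    exact ⟨hx, (key x hx hx1).2 hK⟩

/-- The facets of the union through a face of `R` that misses the origin correspond to the facets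
of `R` through this face. -/
lemma ncard_facets_of_pos (hP : IsCapped P) (hR : IsCorner R) {i : ℕ} (hid : i + 1 ≤ d)
    (hPi : IsSimple i P) (hRi : IsSimple i R) {Λ : Form d} (hv : Valid R Λ) (h0 : 0 < Λ (hom 0))
    (hG : G = zeroSet R Λ) (hne : G.Nonempty) (hr : Module.finrank ℝ (homSpan G) = d - i) :
    {H | IsFacet (glue P R) H ∧ G ⊆ H}.ncard = i + 1 := by
  have hQ := isOrthantBody_glue hP hR
  have hGR : G ⊆ R := hG ▸ zeroSet_subset R Λ
  have hGQ : G ⊆ glue P R := by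
    rw [hG, ← zeroSet_glue_of_pos hP hR h0 (valid_glue_of_pos hP hR h0 hv)]
    exact zeroSet_subset _ _
  have hB : facetsOn P G (· < 0) = ∅ := by
    by_cases hGP : G ⊆ P
    · have h1 : ∀ x ∈ G, height x = 1 := fun x hx =>
        height_eq_one_of_zero hR.toIsOrthantBody hv (hP.nonneg x (hGP hx)) (hG ▸ hx).2
          (Or.inl ⟨h0, hP.height_le x (hGP hx)⟩)
      obtain ⟨K, hK⟩ := zeroSet_eq_of_height hR.toIsOrthantBody hv (hG ▸ h1)
      refine facetsOn_neg_eq_empty hP hid hPi hne hr h1 (K := K) ?_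
      rw [hG, hK]
      ext x
      constructor
      · rintro ⟨hx, hx1, hxK⟩
        exact ⟨(mem_glue_height_eq_one hP hR (hR.nonneg x hx) hx1).1, hx1, hxK⟩
      · rintro ⟨hx, hx1, hxK⟩
        exact ⟨(mem_glue_height_eq_one hP hR (hP.nonneg x hx) hx1).2, hx1, hxK⟩
    · rw [Set.eq_empty_iff_forall_notMem]
      rintro H ⟨hGH, -, M, -, -, rfl⟩
      exact hGP fun x hx => (hGH hx).1
  have hRc := hRi G (isFace_of_finrank hv hG hne (by omega))
  rw [facets_eq hne, facetsOn_corner_neg hR, Set.union_empty] at hRc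
  have hfin : (facetsOn R G (0 < ·)).Finite :=
    (Set.finite_of_ncard_ne_zero (by omega)).subset
      (Set.subset_union_left (t := facetsOn R G (· = 0)))
  have hX := fun H (hH : H ∈ facetsOn R G (0 < ·)) => exists_form_of_mem_facetsOn (lt_irrefl 0) hH
  rw [facets_eq hne, facetsOn_glue_pos hP hR, facetsOn_glue_neg hP hR, hB, Set.union_empty,
    ncard_union_facetsOn_zero hQ hGQ hfin hX, ← hRc,
    ncard_union_facetsOn_zero hR.toIsOrthantBody hGR hfin hX]

lemma facetsOn_neg_nonempty (hP : IsCapped P) {Λ : Form d} (hv : Valid P Λ) (h0 : Λ (hom 0) < 0) :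
    (facetsOn P (zeroSet P Λ) (· < 0)).Nonempty := by
  have hconv := hP.isPolytope.convexHull_vertices
  have hv' : Valid (vertices P) Λ := fun x hx => hv x (vertices_subset P hx)
  obtain ⟨M, hM, hsub, hM0, hMr⟩ := exists_facet_form hP.isPolytope.vertices_finite
    (by rw [← homSpan_convexHull, hconv, hP.homSpan_eq_top]) hv' h0
  have e1 := zeroSet_convexHull hv'
  have e2 := zeroSet_convexHull hM
  rw [hconv] at e1 e2
  refine ⟨zeroSet P M, ?_, ?_, M, hconv ▸ valid_convexHull hM, hM0, rfl⟩
  · rw [e1, e2]; exact convexHull_mono hsub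
  · rw [e2, homSpan_convexHull, hMr]

/-- A coordinate face of the union that lies in the common simplex facet is a face of `R` that
misses the origin: add a large multiple of the sum of the coordinates in `K` to `1 - height`. -/
lemma coordFace_glue_eq_zeroSet (hP : IsCapped P) (hR : IsCorner R) {K : Finset (Fin d)}
    (h1 : ∀ x ∈ coordFace (glue P R) K, height x = 1) :
    ∃ Λ : Form d, Valid R Λ ∧ 0 < Λ (hom 0) ∧ coordFace (glue P R) K = zeroSet R Λ := by
  have hRp := hR.isPolytope
  have hconv := hRp.convexHull_vertices
  obtain ⟨N, hN⟩ : ∃ N : ℝ, ∀ w ∈ vertices R, (height w - 1) / ∑ k ∈ K, w k < N := by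
    obtain ⟨N, hN⟩ := (hRp.vertices_finite.image
      fun w => (height w - 1) / ∑ k ∈ K, w k).bddAbove
    exact ⟨N + 1, fun w hw => by linarith [hN ⟨w, hw, rfl⟩]⟩
  set Λ : Form d := depthForm + N • ∑ k ∈ K, coordForm k with hΛ
  have hev : ∀ x, Λ (hom x) = (1 - height x) + N * ∑ k ∈ K, x k := fun x => by
    rw [hΛ, LinearMap.add_apply, depthForm_hom, LinearMap.smul_apply, sum_coordForm_hom,
      smul_eq_mul]
  -- a vertex with `height > 1` has a positive coordinate in `K`, and `N` outweighs its height
  have hvert : ∀ w ∈ vertices R, ((∀ k ∈ K, w k = 0) ∧ height w ≤ 1) ∨ 0 < Λ (hom w) := by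
    intro w hw
    have hwR := vertices_subset R hw
    have hnn : 0 ≤ ∑ k ∈ K, w k := Finset.sum_nonneg fun k _ => hR.nonneg w hwR k
    rcases hnn.eq_or_lt with h | h
    · left
      have hwK := (Finset.sum_eq_zero_iff_of_nonneg fun k _ => hR.nonneg w hwR k).1 h.symm
      refine ⟨hwK, ?_⟩
      by_contra! hcon
      exact hcon.ne' (h1 w ⟨Or.inr ⟨hwR, hcon.le⟩, hwK⟩)
    · right
      have := hN w hw
      rw [div_lt_iff₀ h] at this
      rw [hev]
      linarith
  have hv : Valid (vertices R) Λ := by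
    intro w hw
    rcases hvert w hw with ⟨hwK, hw1⟩ | h
    · rw [hev, Finset.sum_eq_zero hwK]
      linarith
    · exact h.le
  refine ⟨Λ, hconv ▸ valid_convexHull hv, by simp [hev], ?_⟩
  apply Set.Subset.antisymm
  · intro x hx
    have hx1 := h1 x hx
    refine ⟨(mem_glue_height_eq_one hP hR (glue_nonneg hP hR x hx.1) hx1).2, ?_⟩
    rw [hev, hx1, Finset.sum_eq_zero hx.2]
    simp
  · have hz := zeroSet_convexHull hv
    rw [hconv] at hz
    have hcoord : ∀ w ∈ zeroSet (vertices R) Λ, (∀ k ∈ K, w k = 0) ∧ height w = 1 := by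
      rintro w ⟨hw, hw0⟩
      rcases hvert w hw with ⟨hwK, hw1⟩ | h
      · refine ⟨hwK, ?_⟩
        rw [hev, Finset.sum_eq_zero hwK] at hw0
        linarith
      · exact absurd hw0 h.ne'
    intro x hx
    have hxs : hom x ∈ homSpan (zeroSet (vertices R) Λ) := by
      rw [← homSpan_convexHull, ← hz]
      exact hom_mem_homSpan hx
    have hx1 : depthForm (hom x) = 0 := eq_zero_of_mem_homSpan (fun w hw => by
      rw [depthForm_hom, (hcoord w hw).2, sub_self]) hxs
    rw [depthForm_hom] at hx1
    refine ⟨Or.inr ⟨hx.1, by linarith⟩, fun k hk => ?_⟩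
    exact eq_zero_of_mem_homSpan (Λ := coordForm k) (fun w hw => (hcoord w hw).1 k hk) hxs

lemma isSimple_glue (hP : IsCapped P) (hR : IsCorner R) {i : ℕ} (hid : i + 1 ≤ d)
    (hPi : IsSimple i P) (hRi : IsSimple i R) : IsSimple i (glue P R) := by
  intro G hG
  obtain ⟨hne, ⟨Λ, hv, hGz⟩, hr⟩ := isFace_iff.1 hG
  replace hr : Module.finrank ℝ (homSpan G) = d - i := by omega
  have hQ := isOrthantBody_glue hP hR
  have hGQ : G ⊆ glue P R := hG.subset
  rcases lt_trichotomy (Λ (hom 0)) 0 with h0 | h0 | h0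
  · have hvP := valid_of_valid_glue hv
    rw [zeroSet_glue_of_neg hP hR h0 hv] at hGz
    have hGP : G ⊆ P := hGz ▸ zeroSet_subset P Λ
    by_cases h1 : ∀ x ∈ G, height x = 1
    · obtain ⟨K, hK⟩ := zeroSet_eq_of_height hP.toIsOrthantBody hvP (hGz ▸ h1)
      have hemp := facetsOn_neg_eq_empty hP hid hPi hne hr h1 (hGz.trans hK)
      have hnon := facetsOn_neg_nonempty hP hvP h0
      rw [← hGz, hemp] at hnon
      exact absurd hnon Set.not_nonempty_empty
    · push Not at h1
      obtain ⟨x, hx, hx1⟩ := h1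
      have hlow : ∃ x ∈ G, (∀ k, 0 ≤ x k) ∧ height x < 1 :=
        ⟨x, hx, hP.nonneg x (hGP hx), lt_of_le_of_ne (hP.height_le x (hGP hx)) hx1⟩
      have hPc := hPi G (isFace_of_finrank hvP hGz hne (by omega))
      rw [facets_eq hne, facetsOn_pos_eq_empty hP.toIsOrthantBody hlow, Set.empty_union] at hPc
      have hfin : (facetsOn P G (· < 0)).Finite :=
        (Set.finite_of_ncard_ne_zero (by omega)).subset
          (Set.subset_union_left (t := facetsOn P G (· = 0)))
      have hX := fun H (hH : H ∈ facetsOn P G (· < 0)) =>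
        exists_form_of_mem_facetsOn (p := (· < 0)) (lt_irrefl 0) hH
      rw [facets_eq hne, facetsOn_pos_eq_empty hQ hlow, Set.empty_union, facetsOn_glue_neg hP hR,
        ncard_union_facetsOn_zero hQ hGQ hfin hX, ← hPc,
        ncard_union_facetsOn_zero hP.toIsOrthantBody hGP hfin hX]
  · obtain ⟨K, hK⟩ := zeroSet_eq_coordFace_of_valid hQ h0 hv
    rw [hK] at hGz
    have hGK : ∀ x ∈ G, ∀ k ∈ K, x k = 0 := by rw [hGz]; exact fun x hx => hx.2
    have hu : ∀ k ∉ K, unitVec k ∈ G := by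
      rw [hGz]; exact fun k hk => hQ.unitVec_mem_coordFace hk
    have e1 := finrank_add_card_le hGK
    have e2 := le_finrank_add_card hu
    rcases (by omega : K.card = i + 1 ∨ K.card = i) with h | h
    · -- the origin lies in the span of `G`, so that only coordinate facets contain `G`
      have hspan : hom 0 ∈ homSpan G := hom_mem_of_finrank hGK (by omega) (by simp)
      have hemp : ∀ p : ℝ → Prop, ¬ p 0 → facetsOn (glue P R) G p = ∅ := by
        intro p hp
        rw [Set.eq_empty_iff_forall_notMem]
        rintro H hH
        obtain ⟨M, hM0, hM⟩ := exists_form_of_mem_facetsOn hp hH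
        exact hM0 (eq_zero_of_mem_homSpan (fun x hx => hM x (hH.1 hx)) hspan)
      have hcoords : zeroCoords G = (K : Set (Fin d)) := by
        ext k
        constructor
        · intro hk
          by_contra hkK
          have := hk _ (hu k hkK)
          simp at this
        · exact fun hk x hx => hGK x hx k hk
      rw [facets_eq hne, hemp (0 < ·) (lt_irrefl 0), hemp (· < 0) (lt_irrefl 0), Set.union_empty,
        ncard_union_facetsOn_zero hQ hGQ Set.finite_empty (fun H hH => hH.elim),
        Set.ncard_empty, hcoords, Set.ncard_coe_finset, h, zero_add]
    · have h1 : ∀ x ∈ G, height x = 1 := fun x hx => height_eq_one_of_finrank hu (by omega) hx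
      obtain ⟨M, hM, hM0, hMz⟩ := coordFace_glue_eq_zeroSet hP hR (hGz ▸ h1)
      exact ncard_facets_of_pos hP hR hid hPi hRi hM hM0 (hGz.trans hMz) hne hr
  · exact ncard_facets_of_pos hP hR hid hPi hRi (valid_of_valid_glue_of_pos hP hR h0 hv) h0
      (hGz.trans (zeroSet_glue_of_pos hP hR h0 hv)) hne hr

end Glue

/-! ### Passing to standard coordinates -/

lemma exists_affineEquiv {v : E d} {b : Fin d → E d} (h : LinearIndependent ℝ fun k => b k - v) :
    ∃ S : E d ≃ᵃ[ℝ] E d, S v = 0 ∧ ∀ k, S (b k) = unitVec k := by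
  let B := basisOfLinearIndependentOfCardEqFinrank' _ h (by simp)
  let A : E d ≃ₗ[ℝ] E d := B.equiv (EuclideanSpace.basisFun (Fin d) ℝ).toBasis (Equiv.refl _)
  have hS : ∀ x, ((AffineEquiv.constVAdd ℝ (E d) (-v)).trans A.toAffineEquiv) x = A (x - v) := by
    intro x
    simp [sub_eq_add_neg, add_comm]
  refine ⟨(AffineEquiv.constVAdd ℝ (E d) (-v)).trans A.toAffineEquiv, ?_, fun k => ?_⟩
  · rw [hS]; simp
  · rw [hS]
    have : b k - v = B k := by simp [B]
    rw [this, Module.Basis.equiv_apply]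
    simp [unitVec]

lemma linearIndependent_sub {u : E d} {q : Fin d → E d}
    (h : AffineIndependent ℝ (Fin.cons u q : Fin (d + 1) → E d)) :
    LinearIndependent ℝ fun k => q k - u := by
  rw [affineIndependent_iff_hom, Fintype.linearIndependent_iff] at h
  rw [Fintype.linearIndependent_iff]
  intro g hg k
  have h1 := h (Fin.cons (-∑ k, g k) g) (by
    rw [Fin.sum_univ_succ]
    simp only [Fin.cons_zero, Fin.cons_succ]
    have e : ∀ k, hom (q k) = (q k - u, 0) + hom u := fun k => by simp [hom]
    have e2 : ∑ k, g k • ((q k - u, (0 : ℝ)) : E d × ℝ) = 0 := by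
      rw [Prod.ext_iff, Prod.fst_sum, Prod.snd_sum]
      exact ⟨hg, by simp⟩
    simp only [e, smul_add, Finset.sum_add_distrib, e2, zero_add]
    rw [← Finset.sum_smul, ← add_smul, neg_add_cancel, zero_smul]) k.succ
  simpa using h1

/-- The edge directions at a vertex of a `d`-polytope span the space, so they are linearly
independent if there are only `d` of them. -/
lemma linearIndependent_neighbors {P : Set (E d)} (hP : IsPolytope P) {v : E d}
    (hv : v ∈ vertices P) {b : Fin d → E d} (hb : Set.range b = neighbors P v) :
    LinearIndependent ℝ fun k => b k - v := by
  apply linearIndependent_of_top_le_span_of_card_eq_finrank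
  · set W := Submodule.span ℝ (Set.range fun k => b k - v) with hW
    have hsub : ∀ x ∈ P, x - v ∈ (W : Set (E d)) := by
      refine sub_mem_of_neighbors hP hv W.convex (fun r _ y hy => W.smul_mem r hy) W.zero_mem ?_
      intro w hw
      rw [← hb] at hw
      obtain ⟨k, rfl⟩ := hw
      exact Submodule.subset_span ⟨k, rfl⟩
    have hle : vectorSpan ℝ P ≤ W := by
      rw [vectorSpan_def, Submodule.span_le]
      rintro _ ⟨x, hx, y, hy, rfl⟩
      have := W.sub_mem (hsub x hx) (hsub y hy)
      simpa using this
    have htop : vectorSpan ℝ P = ⊤ := by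
      apply Submodule.eq_top_of_finrank_eq
      have : Module.finrank ℝ (vectorSpan ℝ P) = d := hP.2.2
      rw [this]; simp
    rwa [htop] at hle
  · simp

lemma isCorner_image {P : Set (E d)} (hP : IsPolytope P) {v : E d} (hv : v ∈ vertices P)
    {b : Fin d → E d} (hb : Set.range b = neighbors P v) {S : E d ≃ᵃ[ℝ] E d} (hSv : S v = 0)
    (hSb : ∀ k, S (b k) = unitVec k) : IsCorner (S '' P) := by
  have hlin : ∀ x, S x = S.linear (x - v) := by
    intro x
    have h : S.linear (x - v) = S x - S v := S.toAffineMap.linearMap_vsub x v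
    rw [h, hSv, sub_zero]
  apply isCorner_of_nonneg
  · have := (posOn_affineForm S P).isPolytope_image hP
    rwa [projMap_affineForm] at this
  · rintro _ ⟨x, hx, rfl⟩
    have := sub_mem_of_neighbors hP hv (K := {y | ∀ k, 0 ≤ (S.linear y) k}) ?_ ?_ ?_ ?_ x hx
    · rw [hlin]; exact this
    · intro x hx y hy p q hp hq _ k
      have h1 := mul_nonneg hp (hx k)
      have h2 := mul_nonneg hq (hy k)
      simpa using add_nonneg h1 h2
    · intro r hr y hy k
      simpa using mul_nonneg hr (hy k)
    · intro k; simp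
    · intro w hw k
      rw [← hb] at hw
      obtain ⟨m, rfl⟩ := hw
      rw [← hlin, hSb, unitVec_apply]
      split_ifs <;> norm_num
  · rw [vertices_image]
    exact ⟨v, hv, hSv⟩
  · intro k
    rw [vertices_image]
    have : b k ∈ neighbors P v := hb ▸ Set.mem_range_self k
    exact ⟨b k, this.1, hSb k⟩

lemma nonneg_and_height_le {S : Set (E d)}
    (hS : S ⊆ convexHull ℝ (insert 0 (Set.range unitVec))) :
    ∀ x ∈ S, (∀ k, 0 ≤ x k) ∧ height x ≤ 1 := by
  intro x hx
  refine ⟨fun k => ?_, ?_⟩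
  · have hv : Valid (insert 0 (Set.range unitVec)) (coordForm k) := by
      rintro _ (rfl | ⟨m, rfl⟩)
      · simp
      · rw [coordForm_hom, unitVec_apply]; split_ifs <;> norm_num
    exact valid_convexHull hv x (hS hx)
  · have hv : Valid (insert 0 (Set.range unitVec)) (depthForm : Form d) := by
      rintro _ (rfl | ⟨m, rfl⟩) <;> simp
    have := valid_convexHull hv x (hS hx)
    rw [depthForm_hom] at this
    linarith

lemma isAdjacentFacet_zeroSet (hd : 1 ≤ d) {P : Set (E d)} {a : Fin d → E d}
    (ha : IsSimplexFacet P a) {k : Fin d} {Λ : Form d} (hv : Valid P Λ) (h1 : Λ (hom (a k)) = 1)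
    (h0 : ∀ m, m ≠ k → Λ (hom (a m)) = 0)
    (hr : Module.finrank ℝ (homSpan (zeroSet P Λ)) = d) : IsAdjacentFacet P a k (zeroSet P Λ) := by
  have hsub := ha.2.subset
  have hne : (zeroSet P Λ).Nonempty := by
    by_contra hcon
    rw [Set.not_nonempty_iff_eq_empty] at hcon
    rw [hcon] at hr
    rw [homSpan, Set.image_empty, Submodule.span_empty, finrank_bot] at hr
    omega
  refine ⟨isFacet_iff.2 ⟨hne, ⟨Λ, hv, rfl⟩, hr⟩, fun h => ?_, ?_⟩
  · have : a k ∈ zeroSet P Λ := by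
      rw [h]; exact subset_convexHull ℝ _ (Set.mem_range_self k)
    rw [this.2] at h1
    exact zero_ne_one h1
  · intro x hx
    refine ⟨hsub (convexHull_mono (Set.image_subset_range _ _) hx), ?_⟩
    refine eq_zero_of_mem_homSpan (S := a '' {k}ᶜ) ?_ ?_
    · rintro _ ⟨m, hm, rfl⟩
      exact h0 m hm
    · rw [← homSpan_convexHull]; exact hom_mem_homSpan hx

lemma isCapped_image (hd : 1 ≤ d) {P : Set (E d)} (hP : IsPolytope P) {a : Fin d → E d}
    (ha : IsSimplexFacet P a) {L : (E d × ℝ) ≃ₗ[ℝ] (E d × ℝ)} (hL : PosOn L P)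
    (hLa : ∀ k, projMap L (a k) = unitVec k)
    (hadj : ∀ k H, IsAdjacentFacet P a k H → ∀ x ∈ H, projMap L x k = 0)
    (hsub : projMap L '' P ⊆ convexHull ℝ (insert 0 (Set.range unitVec))) :
    IsCapped (projMap L '' P) := by
  have hpoly := hL.isPolytope_image hP
  have hbd := nonneg_and_height_le hsub
  have hnn := fun x hx => (hbd x hx).1
  refine ⟨⟨hpoly.convex, hnn, fun k => ?_, hpoly.homSpan_eq_top, fun k => ?_⟩, hpoly,
    fun x hx => (hbd x hx).2⟩
  · exact ⟨a k, ha.2.subset (subset_convexHull ℝ _ (Set.mem_range_self k)), hLa k⟩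
  · apply le_antisymm
    · rw [coordFace_singleton_eq hnn]
      exact finrank_homSpan_zeroSet_le _ (coordForm_ne_zero k)
    · obtain ⟨Λ, hv, h1, h0, hr, -⟩ := exists_adjacent_form hP ha k
      have hA := isAdjacentFacet_zeroSet hd ha hv h1 h0 hr
      conv_lhs => rw [← hr, ← (hL.mono (zeroSet_subset P Λ)).finrank_image]
      refine Submodule.finrank_mono (homSpan_mono ?_)
      rintro _ ⟨x, hx, rfl⟩
      refine ⟨⟨x, hx.1, rfl⟩, fun m hm => ?_⟩
      rw [Finset.mem_singleton.1 hm]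
      exact hadj k _ hA x hx

/-- Every merge is an affine image of a glued polytope in standard position. -/
lemma IsMerge.exists_glue (hd : 1 ≤ d) {P₁ P₂ Q : Set (E d)} (hP₁ : IsPolytope P₁)
    (hP₂ : IsPolytope P₂) {a b : Fin d → E d} (ha : IsSimplexFacet P₁ a) {v : E d}
    (hv : v ∈ vertices P₂) (hb : Set.range b = neighbors P₂ v) (hQ : IsMerge P₁ a P₂ v b Q) :
    ∃ (L : (E d × ℝ) ≃ₗ[ℝ] (E d × ℝ)) (S T : E d ≃ᵃ[ℝ] E d), PosOn L P₁ ∧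
      IsCapped (projMap L '' P₁) ∧ IsCorner (T '' P₂) ∧
      Q = S '' glue (projMap L '' P₁) (T '' P₂) := by
  obtain ⟨L₀, u, T, hL₀, hind, hadj, hsub, hTv, hTb, rfl⟩ := hQ
  obtain ⟨L, hL, hLL⟩ := exists_posOn hP₁.convex hL₀
  rw [← hLL] at hind hadj hsub ⊢
  simp only [← hLL] at hTb
  obtain ⟨S, hSu, hSa⟩ := exists_affineEquiv (linearIndependent_sub hind)
  have hproj : ∀ x ∈ P₁, projMap (L.trans (affineForm S)) x = S (projMap L x) :=
    fun x hx => projMap_trans_affineForm S (hL x hx).ne'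
  have hL' : PosOn (L.trans (affineForm S)) P₁ := hL
  have haP : ∀ k, a k ∈ P₁ := fun k =>
    ha.2.subset (subset_convexHull ℝ _ (Set.mem_range_self k))
  have himg : projMap (L.trans (affineForm S)) '' P₁ = S '' (projMap L '' P₁) := by
    rw [Set.image_image]
    exact Set.image_congr hproj
  have hcap : IsCapped (projMap (L.trans (affineForm S)) '' P₁) := by
    refine isCapped_image hd hP₁ ha hL' (fun k => by rw [hproj _ (haP k), hSa]) ?_ ?_
    · intro k H hH x hx
      rw [hproj _ (hH.1.subset hx)]
      have h1 : projMap L x ∈ affineSpan ℝ (projMap L '' H) :=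
        subset_affineSpan ℝ _ ⟨x, hx, rfl⟩
      rw [hadj k H hH] at h1
      have h2 : affineSpan ℝ (insert u ((fun m => projMap L (a m)) '' {k}ᶜ)) ≤
          (LinearMap.ker (EuclideanSpace.proj k : E d →L[ℝ] ℝ).toLinearMap).toAffineSubspace.comap
            S.toAffineMap := by
        rw [affineSpan_le]
        rintro _ (rfl | ⟨m, hm, rfl⟩)
        · change S _ k = 0
          rw [hSu]; rfl
        · change S _ k = 0
          rw [hSa]
          exact unitVec_of_ne fun h => hm h.symm
      exact h2 h1
    · rw [himg]
      have h1 := Set.image_mono (f := S) hsub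
      have h2 := S.toAffineMap.image_convexHull (𝕜 := ℝ)
        (insert u (Set.range fun k => projMap L (a k)))
      change S '' _ = convexHull ℝ (S '' _) at h2
      rw [h2, Set.image_insert_eq, hSu, ← Set.range_comp] at h1
      have h3 : (S ∘ fun k => projMap L (a k)) = unitVec := funext hSa
      rwa [h3] at h1
  have hcor : IsCorner (T.trans S '' P₂) :=
    isCorner_image hP₂ hv hb (by simp [hTv, hSu]) (fun k => by simp [hTb, hSa])
  refine ⟨L.trans (affineForm S), S.symm, T.trans S, hL', hcap, hcor, ?_⟩
  have hST : T.trans S '' P₂ = S '' (T '' P₂) := by rw [Set.image_image]; rfl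
  have hglue : glue (projMap (L.trans (affineForm S)) '' P₁) (T.trans S '' P₂) =
      S '' (projMap L '' P₁ ∪ convexHull ℝ (vertices (T '' P₂) \ {u})) := by
    have h2 := S.toAffineMap.image_convexHull (𝕜 := ℝ) (vertices (T '' P₂) \ {u})
    change S '' _ = convexHull ℝ (S '' _) at h2
    unfold glue
    rw [← hcor.convexHull_vertices_diff, himg, hST, vertices_image S, Set.image_union, h2,
      Set.image_sdiff S.injective, Set.image_singleton, hSu]
  rw [hglue, Set.image_image]
  simp

/-! ### Existence of merges -/

lemma affineSpan_eq_of_finrank {A B : Set (E d)} (hA : A.Nonempty) (hB : B.Nonempty)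
    (hAB : A ⊆ affineSpan ℝ B)
    (hr : Module.finrank ℝ (homSpan A) = Module.finrank ℝ (homSpan B)) :
    affineSpan ℝ A = affineSpan ℝ B := by
  have hle : affineSpan ℝ A ≤ affineSpan ℝ B := affineSpan_le.2 hAB
  refine AffineSubspace.eq_of_direction_eq_of_nonempty_of_le ?_ ((affineSpan_nonempty ℝ).2 hA) hle
  apply Submodule.eq_of_le_of_finrank_eq (AffineSubspace.direction_le hle)
  rw [direction_affineSpan, direction_affineSpan]
  rw [← dim_add_one hA, ← dim_add_one hB] at hr
  unfold dim at hr
  omega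

/-- The projective transformation of a merge is given by the affine functions of the facets adjacent
to the simplex facet, with the sum of these and the function of the simplex facet itself as
denominator. -/
lemma exists_merge {P₁ P₂ : Set (E d)} (hP₁ : IsPolytope P₁)
    (hP₂ : IsPolytope P₂) {a b : Fin d → E d} (ha : IsSimplexFacet P₁ a) {v : E d}
    (hv : v ∈ vertices P₂) (hb : Set.range b = neighbors P₂ v) :
    ∃ Q, IsMerge P₁ a P₂ v b Q := by
  obtain ⟨T, hTv, hTb⟩ := exists_affineEquiv (linearIndependent_neighbors hP₂ hv hb)
  choose Λ hΛv hΛ1 hΛ0 hΛr hΛadj using fun k => exists_adjacent_form hP₁ ha k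
  obtain ⟨-, ⟨Λ₀, hv₀, hF⟩, hrF⟩ := isFacet_iff.1 ha.2
  have hind := affineIndependent_iff_hom.1 ha.1
  have haF : ∀ m, a m ∈ zeroSet P₁ Λ₀ := fun m =>
    hF ▸ subset_convexHull ℝ _ (Set.mem_range_self m)
  have hΛ₀ : Λ₀ ≠ 0 := by
    rintro rfl
    have : zeroSet P₁ 0 = P₁ := by ext x; simp [zeroSet]
    rw [hF, this, hP₁.homSpan_eq_top, finrank_top, finrank_hom] at hrF
    omega
  let M : (E d × ℝ) →ₗ[ℝ] (E d × ℝ) := LinearMap.prod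
    ((WithLp.linearEquiv 2 ℝ (Fin d → ℝ)).symm.toLinearMap ∘ₗ LinearMap.pi Λ) (Λ₀ + ∑ k, Λ k)
  have hM1 : ∀ y k, (M y).1 k = Λ k y := fun y k => rfl
  have hM2 : ∀ y, (M y).2 = Λ₀ y + ∑ k, Λ k y := fun y => by simp [M]
  -- the kernel of `Λ₀` is spanned by the vertices of the simplex facet
  have hker : LinearMap.ker Λ₀ ≤ Submodule.span ℝ (Set.range fun m => hom (a m)) := by
    have hle : Submodule.span ℝ (Set.range fun m => hom (a m)) ≤ LinearMap.ker Λ₀ := by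
      rw [Submodule.span_le]
      rintro _ ⟨m, rfl⟩
      exact (haF m).2
    refine (Submodule.eq_of_le_of_finrank_le hle ?_).ge
    have h2 : LinearMap.ker Λ₀ < ⊤ :=
      lt_top_iff_ne_top.2 fun h => hΛ₀ (LinearMap.ker_eq_top.1 h)
    have h3 := Submodule.finrank_lt_finrank_of_lt h2
    rw [finrank_top, finrank_hom] at h3
    rw [finrank_span_eq_card hind, Fintype.card_fin]
    omega
  have hMinj : Function.Injective M := by
    rw [← LinearMap.ker_eq_bot, LinearMap.ker_eq_bot']
    intro y hy
    have hk : ∀ k, Λ k y = 0 := fun k => by rw [← hM1, hy]; rfl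
    have h0 : Λ₀ y = 0 := by
      have := hM2 y
      rw [hy] at this
      simpa [hk] using this.symm
    obtain ⟨c, rfl⟩ := (Submodule.mem_span_range_iff_exists_fun ℝ).1 (hker h0)
    refine Finset.sum_eq_zero fun k _ => ?_
    have := hk k
    rw [map_sum, Finset.sum_eq_single k (fun m _ hm => by rw [map_smul, hΛ0 k m hm, smul_zero])
      (fun h => absurd (Finset.mem_univ k) h), map_smul, hΛ1, smul_eq_mul, mul_one] at this
    rw [this, zero_smul]
  let L : (E d × ℝ) ≃ₗ[ℝ] (E d × ℝ) := LinearEquiv.ofInjectiveEndo M hMinj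
  have hden : ∀ x, projDenom L x = Λ₀ (hom x) + ∑ k, Λ k (hom x) := fun x => hM2 (hom x)
  have hcoord : ∀ x k, projMap L x k = (projDenom L x)⁻¹ * Λ k (hom x) := fun x k => rfl
  have hpos : PosOn L P₁ := by
    intro x hx
    have h1 := hv₀ x hx
    have h2 : ∀ k ∈ Finset.univ, 0 ≤ Λ k (hom x) := fun k _ => hΛv k x hx
    have h3 := Finset.sum_nonneg h2
    rw [hden]
    rcases (add_nonneg h1 h3).eq_or_lt with h | h
    · exfalso
      have h4 : ∀ k, Λ k (hom x) = 0 := fun k =>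
        (Finset.sum_eq_zero_iff_of_nonneg h2).1 (by linarith) k (Finset.mem_univ k)
      refine hom_ne_zero x (hMinj ?_)
      rw [map_zero]
      refine Prod.ext ?_ ?_
      · ext k; exact h4 k
      · rw [hM2]; exact h.symm
    · exact h
  have hLa : ∀ k, projMap L (a k) = unitVec k := by
    intro k
    have hsum : ∀ m, Λ m (hom (a k)) = if m = k then 1 else 0 := fun m => by
      by_cases h : m = k
      · subst h; simp [hΛ1]
      · rw [if_neg h, hΛ0 m k (Ne.symm h)]
    ext m
    rw [hcoord, hden, (haF k).2, unitVec_apply]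
    simp [hsum]
  refine ⟨_, L, 0, T, fun x hx => (hpos x hx).ne', ?_, ?_, ?_, hTv, fun k => by rw [hTb, hLa], rfl⟩
  · simp only [hLa]
    rw [affineIndependent_iff_hom]
    have h := (linearIndependent_hom_option (d := d)).comp _ (finSuccEquiv d).injective
    have e : (fun i => hom ((Fin.cons 0 (fun k => unitVec k) : Fin (d + 1) → E d) i)) =
        (fun o : Option (Fin d) => hom (o.elim 0 unitVec)) ∘ finSuccEquiv d := by
      funext i
      refine Fin.cases ?_ (fun k => ?_) i
      · simp
      · simp
    rw [e]
    exact h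
  · intro k H hH
    rw [hΛadj k H hH]
    simp only [hLa]
    have hunit : (fun m => unitVec m) '' ({k}ᶜ : Set (Fin d)) = unitSet {k} := by
      unfold unitSet
      congr 1
      ext m
      simp
    rw [hunit]
    have hne : (zeroSet P₁ (Λ k)).Nonempty := hΛadj k H hH ▸ hH.1.2.1
    apply affineSpan_eq_of_finrank (hne.image _) (Set.insert_nonempty _ _)
    · rintro _ ⟨x, hx, rfl⟩
      rw [affineSpan_insert_zero]
      have hxk : projMap L x k = 0 := by rw [hcoord, hx.2, mul_zero]
      rw [← sum_smul_unitVec (projMap L x)]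
      refine Submodule.sum_mem _ fun m _ => ?_
      by_cases hm : m = k
      · rw [hm, hxk, zero_smul]; exact Submodule.zero_mem _
      · exact Submodule.smul_mem _ _ (Submodule.subset_span ⟨m, by simpa using hm, rfl⟩)
    · rw [(hpos.mono (zeroSet_subset _ _)).finrank_image, hΛr]
      have := finrank_insert_unitSet {k}
      rw [Finset.card_singleton] at this
      omega
  · simp only [hLa]
    rintro _ ⟨x, hx, rfl⟩
    have hp := hpos x hx
    refine mem_of_height_le_one (convex_convexHull ℝ _)
      (subset_convexHull ℝ _ (Set.mem_insert _ _))
      (fun k => subset_convexHull ℝ _ (Set.mem_insert_of_mem _ (Set.mem_range_self k)))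
      (fun k => ?_) ?_
    · rw [hcoord]
      exact mul_nonneg (inv_nonneg.2 hp.le) (hΛv k x hx)
    · have : height (projMap L x) = (projDenom L x)⁻¹ * ∑ k, Λ k (hom x) := by
        simp only [height, hcoord, Finset.mul_sum]
      rw [this, inv_mul_le_iff₀ hp, mul_one, hden]
      linarith [hv₀ x hx]

end PolytopeMerge

theorem theorem4p5 (d : ℕ) (hd : 2 ≤ d) (i j : ℕ) (hi : 1 ≤ i) (hid : i ≤ d - 1)
    (hj : 1 ≤ j) (hjd : j ≤ d - 1)
    (P₁ P₂ : Set (PolytopeMerge.E d))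
    (hP₁ : PolytopeMerge.IsPolytope P₁) (hP₂ : PolytopeMerge.IsPolytope P₂)
    (a : Fin d → PolytopeMerge.E d) (ha : PolytopeMerge.IsSimplexFacet P₁ a)
    (v : PolytopeMerge.E d) (hv : PolytopeMerge.IsSimpleVertex P₂ v)
    (b : Fin d → PolytopeMerge.E d) (hb : Function.Injective b)
    (hbv : Set.range b = PolytopeMerge.neighbors P₂ v) :
    (∃ Q, PolytopeMerge.IsMerge P₁ a P₂ v b Q) ∧
    ∀ Q, PolytopeMerge.IsMerge P₁ a P₂ v b Q →
      PolytopeMerge.IsPolytope Q ∧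
      (PolytopeMerge.IsSimplicial j P₁ → PolytopeMerge.IsSimplicial j P₂ →
        PolytopeMerge.IsSimplicial j Q) ∧
      (PolytopeMerge.IsSimple i P₁ → PolytopeMerge.IsSimple i P₂ →
        PolytopeMerge.IsSimple i Q) := by
  open PolytopeMerge in
  refine ⟨exists_merge hP₁ hP₂ ha hv.1 hbv, fun Q hQ => ?_⟩
  obtain ⟨L, S, T, hL, hP, hR, rfl⟩ := hQ.exists_glue (by omega) hP₁ hP₂ ha hv.1 hbv
  have hS := posOn_affineForm S (glue (projMap L '' P₁) (T '' P₂))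
  have hT := posOn_affineForm T P₂
  rw [← projMap_affineForm S]
  refine ⟨hS.isPolytope_image (isPolytope_glue hP hR), fun h₁ h₂ => ?_, fun h₁ h₂ => ?_⟩
  · have h₂' := hT.isSimplicial_image h₂
    rw [projMap_affineForm] at h₂'
    exact hS.isSimplicial_image (isSimplicial_glue hP hR (hL.isSimplicial_image h₁) h₂')
  · have h₂' := hT.isSimple_image h₂
    rw [projMap_affineForm] at h₂'
    exact hS.isSimple_image (isSimple_glue hP hR (by omega) (hL.isSimple_image h₁) h₂')
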